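/- Conventions. $D^1=[-1,1]$ has basepoint $-1$. For a space $X$ without basepoint, $\Sigma X$ is the unreduced suspension $D^1\times X/\!\sim$, $(-1,x)\sim *_{-1}$, $(1,x)\sim *_1$, with basepoint $*_{-1}$; for a pointed space $X$, $\Sigma^mX=[-1,1]^m\times X/(\partial[-1,1]^m\times X\cup[-1,1]^m\times\{*\})$. $|\Delta^{n-1}|$ is the geometric simplex on the vertex set $[n]$, of which realizations of complexes on $[n]$ are subspaces; it has no basepoint, so $\Sigma|K|$ is unreduced and $\Sigma^n|K|=\Sigma^{n-1}(\Sigma|K|)$. $\mathrm{Cone}(\Sigma|K|)=[0,1]\times\Sigma|K|/\!\sim$ with all $(1,x)$ and all $(t,*_{-1})$ identified to one point $*$. $L_I$ is the full subcomplex of $L$ on $I$, $L\setminus\{i\}=L_{[n]-\{i\}}$, and $M*N$ is the join. For $s\in\mathbb R^n$, $[n]_s=(I_1,\dots,I_m)$ is the ordered partition of $[n]$ where $m$ is the number of distinct values $s_\ell$ and $I_j$ is the set of $\ell$ such that $s_\ell$ is the $j$-th smallest value. $\mathcal K_n$ is the delta set whose $(m-2)$-faces ($m\ge2$) are the ordered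 partitions $\mathcal S=(I_1,\dots,I_m)$ of $[n]$ into nonempty sets, with face maps $d_i$ ($1\le i\le m-1$) replacing $I_i,I_{i+1}$ by $I_i\cup I_{i+1}$; $|\mathcal S|\subseteq|\mathcal K_n|$ is the closed simplex of $\mathcal S$. Put $W=(D^1,S^0)^K$ and $W'=(D^1,S^0)^L$, polyhedral products in $(D^1)^{\times n}$; $\hat W$ is the image of $W$ in $(D^1)^{\wedge n}$, $W'_I$ is the projection of $W'$ to the coordinates in $I$, $\hat W'_I$ its image in the smash product of those coordinates, and $\hat W'_{I_1}\wedge\dots\wedge\hat W'_{I_m}\subseteq(D^1)^{\wedge n}$ by permuting coordinates. Let $L$ be a simplicial complex on a finite vertex set $[n]$, without ghost vertices, and let $K\subseteq L$ be a subcomplex (possibly with fewer vertices; the case $K=L$ is included). Each of the following definitions of "$(L,K)$ is coherently homotopy Golod" has the same recursive form: $L$ is a single vertex, or $K=\emptyset$, or else $(L\setminus\{i\},K\setminus\{i\})$ on the vertex set $[n]-\{i\}$ satisfies the same definition for every $i\in[n]$ and a map as follows exists. First definition: a continuous map $\bar\Psi:|\mathcal K_n|\times \mathrm{Cone}(\Sigma|K|)\to\Sigma|\Delta^{n-1}|$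 with $\bar\Psi(\gamma,*)=*_{-1}$ for all $\gamma$, such that (1) $\bar\Psi(\gamma,(0,x))=x$ for all $\gamma\in|\mathcal K_n|$, $x\in\Sigma|K|$; (2) if $\gamma\in|\mathcal S|$ with $\mathcal S=(I_1,\dots,I_m)$, then $\bar\Psi(\{\gamma\}\times \mathrm{Cone}(\Sigma|K|))\subseteq\Sigma|L_{I_1}*\cdots*L_{I_m}|$. Second definition: for some ordering of the vertices (identifying the vertex set with $\{1,\dots,n\}$), a basepoint preserving continuous map $\Psi:\Sigma^n|K|\to\Sigma|\Delta^{n-1}|$ such that for all $y=(t_1,\dots,t_{n-1})\in(-1,1)^{n-1}$: (1) if $y=0$ then $\Psi(y,x)=x$ for all $x\in\Sigma|K|$; (2) with $(I_1,\dots,I_m)=[n]_{(t_1,\dots,t_{n-1},0)}$, $\Psi(y,x)\in\Sigma|L_{I_1}*\cdots*L_{I_m}|$ for all $x\in\Sigma|K|$. Third definition: the same as the second, but with a basepoint preserving continuous map $\Psi:\Sigma^{n-1}\hat W\to(D^1)^{\wedge n}$, with $x\in\hat W$, and with $\hat W'_{I_1}\wedge\cdots\wedge\hat W'_{I_m}$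 in place of $\Sigma|L_{I_1}*\cdots*L_{I_m}|$. Proposition. The three definitions are equivalent. Moreover the second and the third definition do not depend on the vertex ordering: if orderings of the vertex sets occurring in the recursion are prescribed and the second (respectively third) definition is required with these orderings, the resulting condition is equivalent to the second (respectively third) definition; in particular, if it holds for one choice of orderings then it holds for every choice. -/

import Mathlib

namespace CoherentGolod

universe u

/-! ### Quotients, suspensions, cones and smash products -/

section Spaces

variable {X Y : Type*} [TopologicalSpace X] [TopologicalSpace Y]

/-- `D¹ = [-1, 1]`, with basepoint `-1`. -/
abbrev D1 : Type := Set.Icc (-1 : ℝ) 1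

/-- The relation on `X ⊔ {*}` that identifies all points of `A` with `*`. -/
def collapseSetoid (A : Set X) : Setoid (X ⊕ Unit) where
  r p q := p = q ∨ (p ∈ Sum.inl '' A ∪ {Sum.inr ()} ∧ q ∈ Sum.inl '' A ∪ {Sum.inr ()})
  iseqv :=
    { refl := fun _ => Or.inl rfl
      symm := by
        rintro p q (h | ⟨h, h'⟩)
        · exact Or.inl h.symm
        · exact Or.inr ⟨h', h⟩
      trans := by
        rintro p q r (rfl | ⟨h, h'⟩) (rfl | ⟨k, k'⟩)
        · exact Or.inl rfl
        · exact Or.inr ⟨k, k'⟩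
        · exact Or.inr ⟨h, h'⟩
        · exact Or.inr ⟨h, k'⟩ }

/-- The pointed quotient space `X / A` (which is `X ⊔ {*}` when `A` is empty). -/
def Collapse (A : Set X) : Type _ := Quotient (collapseSetoid A)

instance (A : Set X) : TopologicalSpace (Collapse A) :=
  inferInstanceAs (TopologicalSpace (Quotient (collapseSetoid A)))

/-- The quotient map `X → X / A`. -/
def Collapse.mk (A : Set X) (x : X) : Collapse A := Quotient.mk (collapseSetoid A) (Sum.inl x)

/-- The basepoint of `X / A`. -/
def Collapse.base (A : Set X) : Collapse A := Quotient.mk (collapseSetoid A) (Sum.inr ())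

/-- The identifications of the unreduced suspension: `(-1, x) ∼ *₋₁` and `(1, x) ∼ *₁`, where the
tip `*₋₁` is `Sum.inr false` and the tip `*₁` is `Sum.inr true`. -/
inductive SuspRel (X : Type*) : (D1 × X) ⊕ Bool → (D1 × X) ⊕ Bool → Prop
  | south (t : D1) (x : X) (ht : (t : ℝ) = -1) : SuspRel X (Sum.inl (t, x)) (Sum.inr false)
  | north (t : D1) (x : X) (ht : (t : ℝ) = 1) : SuspRel X (Sum.inl (t, x)) (Sum.inr true)

/-- The unreduced suspension `Σ X` of a space without basepoint. -/
def Susp (X : Type*) : Type _ := Quot (SuspRel X)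

instance : TopologicalSpace (Susp X) :=
  inferInstanceAs (TopologicalSpace (Quot (SuspRel X)))

/-- The basepoint `*₋₁` of `Σ X`. -/
def Susp.base (X : Type*) : Susp X := Quot.mk _ (Sum.inr false)

/-- The map `Σ f : Σ X → Σ Y`, `(t, x) ↦ (t, f x)`. -/
def Susp.map {X Y : Type*} (f : X → Y) : Susp X → Susp Y :=
  Quot.map (Sum.map (Prod.map id f) id) (by
    rintro _ _ (⟨t, x, ht⟩ | ⟨t, x, ht⟩)
    · exact SuspRel.south t (f x) ht
    · exact SuspRel.north t (f x) ht)

/-- The subset of `[0,1] × X` collapsed in the cone: all `(1, x)` and all `(t, *)`. -/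
def coneSet (x₀ : X) : Set (unitInterval × X) := {p | p.1 = 1 ∨ p.2 = x₀}

/-- The reduced cone of the pointed space `(X, x₀)`. -/
abbrev Cone (x₀ : X) : Type _ := Collapse (coneSet x₀)

/-- The subset of `[-1,1]^m × X` collapsed in the `m`-fold reduced suspension. -/
def redSuspSet (m : ℕ) (x₀ : X) : Set ((Fin m → D1) × X) :=
  {p | (∃ i, (p.1 i : ℝ) = -1 ∨ (p.1 i : ℝ) = 1) ∨ p.2 = x₀}

/-- The `m`-fold reduced suspension `Σ^m X` of the pointed space `(X, x₀)`, with points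
`(t_1, …, t_m, x)`. -/
abbrev RedSusp (m : ℕ) (x₀ : X) : Type _ := Collapse (redSuspSet m x₀)

/-- The set of points of the cube `(D¹)^V` with some coordinate at the basepoint. -/
def fatWedge (V : Type*) : Set (V → D1) := {x | ∃ v, (x v : ℝ) = -1}

/-- The smash power `(D¹)^{∧ V}`. -/
abbrev Smash (V : Type*) : Type _ := Collapse (fatWedge V)

end Spaces

/-! ### Simplicial complexes

Faces are nonempty finite sets, the empty simplex being implicit; the complex `∅` is `⊥`. A complex
on the vertex set `V` has all its faces contained in `V`. -/

section Complexes

variable {ι : Type u} [DecidableEq ι]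

/-- The full subcomplex `L_I`. In particular `L \ {i}`, for `L` on the vertex set `V`, is
`restrict L (V.erase i)`. -/
def restrict (L : PreAbstractSimplicialComplex ι) (I : Finset ι) :
    PreAbstractSimplicialComplex ι where
  faces := {σ | σ ∈ L.faces ∧ σ ⊆ I}
  isRelLowerSet_faces := by
    rintro σ ⟨hσ, hI⟩
    exact ⟨(L.isRelLowerSet_faces hσ).1, fun τ hτ hne =>
      ⟨(L.isRelLowerSet_faces hσ).2 hτ hne, Finset.Subset.trans hτ hI⟩⟩

/-- The join `M_1 ∗ ⋯ ∗ M_m` of complexes on disjoint sets of vertices: its faces are the nonempty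
unions `σ_1 ∪ ⋯ ∪ σ_m`, where each `σ_j` is a face of `M_j` or empty. -/
def join {m : ℕ} (M : Fin m → PreAbstractSimplicialComplex ι) :
    PreAbstractSimplicialComplex ι where
  faces := {σ | σ.Nonempty ∧ ∃ τ : Fin m → Finset ι,
    (∀ j, τ j = ∅ ∨ τ j ∈ (M j).faces) ∧ σ = Finset.univ.biUnion τ}
  isRelLowerSet_faces := by
    rintro σ ⟨hne, τ, hτ, rfl⟩
    refine ⟨hne, fun ρ hρ hρne => ⟨hρne, fun j => τ j ∩ ρ, fun j => ?_, ?_⟩⟩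
    · rcases Finset.eq_empty_or_nonempty (τ j ∩ ρ) with h | h
      · exact Or.inl h
      · rcases hτ j with h0 | h0
        · simp [h0] at h
        · exact Or.inr (((M j).isRelLowerSet_faces h0).2 Finset.inter_subset_left h)
    · ext v
      constructor
      · intro hv
        have h1 := hρ hv
        simp only [Finset.mem_biUnion, Finset.mem_univ, true_and] at h1
        obtain ⟨j, hj⟩ := h1
        simp only [Finset.mem_biUnion, Finset.mem_univ, true_and, Finset.mem_inter]
        exact ⟨j, hj, hv⟩
      · intro hv
        simp only [Finset.mem_biUnion, Finset.mem_univ, true_and, Finset.mem_inter] at hv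
        obtain ⟨_, _, h⟩ := hv
        exact h

/-- The geometric realization of a complex on the vertex set `V`, as a subspace of the geometric
simplex `|Δ^{n-1}|` with vertex set `V`. -/
def realization (V : Finset ι) (M : PreAbstractSimplicialComplex ι) : Set (stdSimplex ℝ V) :=
  {x | ∃ σ ∈ M.faces, ∀ v : V, (v : ι) ∉ σ → x v = 0}

/-- The suspended inclusion `Σ|M| → Σ|Δ^{n-1}|`. -/
def suspIncl (V : Finset ι) (M : PreAbstractSimplicialComplex ι) :
    Susp (realization V M) → Susp (stdSimplex ℝ V) :=
  Susp.map Subtype.val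

/-- The polyhedral product `(D¹, S⁰)^K ⊆ (D¹)^V`. -/
def polyProd (V : Finset ι) (K : PreAbstractSimplicialComplex ι) : Set (V → D1) :=
  {x | ∃ σ : Finset ι, (σ = ∅ ∨ σ ∈ K.faces) ∧
    ∀ v : V, (v : ι) ∉ σ → (x v : ℝ) = -1 ∨ (x v : ℝ) = 1}

/-- The pointed subspace of `(D¹)^{∧ V}` which is the image of a subspace of the cube. -/
def hat {V : Finset ι} (A : Set (V → D1)) : Set (Smash V) :=
  insert (Collapse.base _) (Collapse.mk _ '' A)

/-- The basepoint of the subspace `hat A`. -/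
def hatBase {V : Finset ι} (A : Set (V → D1)) : hat A := ⟨Collapse.base _, Or.inl rfl⟩

/-! ### Ordered partitions -/

/-- Ordered partitions `(I_1, …, I_m)` of `V` of length `m` into nonempty subsets. -/
@[ext]
structure OrderedPartition (V : Finset ι) (m : ℕ) where
  parts : Fin m → Finset ι
  nonempty : ∀ j, (parts j).Nonempty
  disjoint : ∀ j k, j ≠ k → Disjoint (parts j) (parts k)
  cover : Finset.univ.biUnion parts = V

/-- The face map `d_i`, which replaces the consecutive parts `I_i, I_{i+1}` by their union:
`i.predAbove` is the weakly increasing surjection that identifies `i` and `i + 1`. -/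
def OrderedPartition.face {V : Finset ι} {k : ℕ} (S : OrderedPartition V (k + 1)) (i : Fin k) :
    OrderedPartition V k where
  parts j := (Finset.univ.filter fun l => i.predAbove l = j).biUnion S.parts
  nonempty j := by
    obtain ⟨l, hl⟩ := Fin.predAbove_surjective i j
    obtain ⟨v, hv⟩ := S.nonempty l
    exact ⟨v, Finset.mem_biUnion.2 ⟨l, by simpa using hl, hv⟩⟩
  disjoint j k hjk := by
    rw [Finset.disjoint_biUnion_left]
    intro a ha
    rw [Finset.disjoint_biUnion_right]
    intro b hb
    refine S.disjoint a b ?_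
    rintro rfl
    simp only [Finset.mem_filter, Finset.mem_univ, true_and] at ha hb
    exact hjk (ha.symm.trans hb)
  cover := by
    refine Eq.trans ?_ S.cover
    ext v
    simp

/-- The ordered partition `V_s = (I_1, …, I_m)` given by real numbers `s v`, `v ∈ V`: here `m` is
the number of distinct values of `s`, and `I_j` is the set of all `v` such that `s v` is the `j`-th
smallest value. -/
noncomputable def levelPartition {V : Finset ι} (s : V → ℝ) :
    OrderedPartition V (Finset.univ.image s).card where
  parts j := (Finset.univ.filter fun v : V =>
    s v = (Finset.univ.image s).orderEmbOfFin rfl j).map (Function.Embedding.subtype _)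
  nonempty j := by
    have h := Finset.orderEmbOfFin_mem (Finset.univ.image s) rfl j
    obtain ⟨v, -, hv⟩ := Finset.mem_image.1 h
    exact ⟨v, Finset.mem_map.2 ⟨v, Finset.mem_filter.2 ⟨Finset.mem_univ v, hv⟩, rfl⟩⟩
  disjoint j k hjk := by
    rw [Finset.disjoint_map, Finset.disjoint_filter]
    intro v _ h1 h2
    exact hjk (((Finset.univ.image s).orderEmbOfFin rfl).injective (h1.symm.trans h2))
  cover := by
    ext v
    simp only [Finset.mem_biUnion, Finset.mem_univ, true_and, Finset.mem_map, Finset.mem_filter]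
    constructor
    · rintro ⟨j, w, -, rfl⟩
      exact w.2
    · intro hv
      have h : s ⟨v, hv⟩ ∈ Set.range ((Finset.univ.image s).orderEmbOfFin rfl) := by
        rw [Finset.range_orderEmbOfFin]
        simp
      obtain ⟨j, hj⟩ := h
      exact ⟨j, ⟨v, hv⟩, hj.symm, rfl⟩

/-- The join `L_{I_1} ∗ ⋯ ∗ L_{I_m}` for an ordered partition `(I_1, …, I_m)`. -/
def partitionJoin {V : Finset ι} {m : ℕ} (L : PreAbstractSimplicialComplex ι)
    (S : OrderedPartition V m) : PreAbstractSimplicialComplex ι :=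
  join fun j => restrict L (S.parts j)

/-- The subspace `Σ|L_{I_1} ∗ ⋯ ∗ L_{I_m}|` of `Σ|Δ^{n-1}|`. -/
def suspJoin {V : Finset ι} {m : ℕ} (L : PreAbstractSimplicialComplex ι)
    (S : OrderedPartition V m) : Set (Susp (stdSimplex ℝ V)) :=
  Set.range (suspIncl V (partitionJoin L S))

/-- The subspace `Ŵ'_{I_1} ∧ ⋯ ∧ Ŵ'_{I_m}` of `(D¹)^{∧ V}`, where `W' = (D¹, S⁰)^L` and `W'_I` is the
projection of `W'` to the coordinates in `I`. -/
def smashJoin {V : Finset ι} {m : ℕ} (L : PreAbstractSimplicialComplex ι)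
    (S : OrderedPartition V m) : Set (Smash V) :=
  hat {x : V → D1 | ∀ j, ∃ w ∈ polyProd V L, ∀ v : V, (v : ι) ∈ S.parts j → x v = w v}

/-! ### The delta set of ordered partitions and its realization -/

/-- The disjoint union of the simplices of the delta set of ordered partitions of `V`: an ordered
partition of length `k + 2` gives a `k`-simplex. -/
abbrev PartitionSimplices (V : Finset ι) : Type u :=
  Σ S : (Σ k : ℕ, OrderedPartition V (k + 2)), stdSimplex ℝ (Fin (S.1 + 1))

/-- The gluing relation of the realization: the simplex of `d_i S` is the `i`-th facet (opposite to
the `i`-th vertex) of the simplex of `S`. -/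
inductive PartitionGlue (V : Finset ι) : PartitionSimplices V → PartitionSimplices V → Prop
  | glue (k : ℕ) (S : OrderedPartition V (k + 3)) (i : Fin (k + 2))
      (a : stdSimplex ℝ (Fin (k + 1))) :
      PartitionGlue V ⟨⟨k, S.face i⟩, a⟩ ⟨⟨k + 1, S⟩, stdSimplex.map i.succAbove a⟩

/-- The geometric realization of the delta set `𝒦_n` of ordered partitions of `V`. -/
def PartitionSpace (V : Finset ι) : Type u := Quot (PartitionGlue V)

instance (V : Finset ι) : TopologicalSpace (PartitionSpace V) :=
  inferInstanceAs (TopologicalSpace (Quot (PartitionGlue V)))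

/-- The characteristic map of the simplex `|S|`; its range is the closed simplex `|S|`. -/
def PartitionSpace.cell {V : Finset ι} {k : ℕ} (S : OrderedPartition V (k + 2))
    (a : stdSimplex ℝ (Fin (k + 1))) : PartitionSpace V :=
  Quot.mk _ ⟨⟨k, S⟩, a⟩

/-! ### The three definitions of coherent homotopy Golodness -/

/-- Existence of the map `|𝒦_n| × Cone(Σ|K|) → Σ|Δ^{n-1}|` of the first definition. -/
def HasMap1 (V : Finset ι) (L K : PreAbstractSimplicialComplex ι) : Prop :=
  ∃ Ψ : C(PartitionSpace V × Cone (Susp.base (realization V K)), Susp (stdSimplex ℝ V)),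
    (∀ γ, Ψ (γ, Collapse.base _) = Susp.base _) ∧
    (∀ γ (x : Susp (realization V K)),
      Ψ (γ, Collapse.mk _ ((0 : unitInterval), x)) = suspIncl V K x) ∧
    (∀ (k : ℕ) (S : OrderedPartition V (k + 2)), ∀ γ ∈ Set.range (PartitionSpace.cell S),
      ∀ c, Ψ (γ, c) ∈ suspJoin L S)

/-- The sequence `(t_1, …, t_{n-1}, 0)` as a function on the vertex set, for the vertex ordering
`e`. -/
noncomputable def labels {V : Finset ι} (e : Fin V.card ≃ V) (y : Fin (V.card - 1) → D1) :
    V → ℝ :=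
  fun v => if h : (e.symm v : ℕ) < V.card - 1 then (y ⟨e.symm v, h⟩ : ℝ) else 0

/-- Existence of the map `Σ^n|K| → Σ|Δ^{n-1}|` of the second definition, for the vertex ordering
`e`. Here `Σ^n|K|` is the `(n-1)`-fold reduced suspension of `Σ|K|`. -/
def HasMap2 (V : Finset ι) (e : Fin V.card ≃ V) (L K : PreAbstractSimplicialComplex ι) : Prop :=
  ∃ Ψ : C(RedSusp (V.card - 1) (Susp.base (realization V K)), Susp (stdSimplex ℝ V)),
    Ψ (Collapse.base _) = Susp.base _ ∧
    ∀ y : Fin (V.card - 1) → D1, (∀ i, (y i : ℝ) ≠ -1 ∧ (y i : ℝ) ≠ 1) →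
      ((∀ i, (y i : ℝ) = 0) → ∀ x, Ψ (Collapse.mk _ (y, x)) = suspIncl V K x) ∧
      (∀ x, Ψ (Collapse.mk _ (y, x)) ∈ suspJoin L (levelPartition (labels e y)))

/-- Existence of the map `Σ^{n-1}Ŵ → (D¹)^{∧n}`, `W = (D¹, S⁰)^K`, of the third definition, for the
vertex ordering `e`. -/
def HasMap3 (V : Finset ι) (e : Fin V.card ≃ V) (L K : PreAbstractSimplicialComplex ι) : Prop :=
  ∃ Ψ : C(RedSusp (V.card - 1) (hatBase (polyProd V K)), Smash V),
    Ψ (Collapse.base _) = Collapse.base _ ∧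
    ∀ y : Fin (V.card - 1) → D1, (∀ i, (y i : ℝ) ≠ -1 ∧ (y i : ℝ) ≠ 1) →
      ((∀ i, (y i : ℝ) = 0) →
        ∀ x : hat (polyProd V K), Ψ (Collapse.mk _ (y, x)) = (x : Smash V)) ∧
      (∀ x : hat (polyProd V K),
        Ψ (Collapse.mk _ (y, x)) ∈ smashJoin L (levelPartition (labels e y)))

/-- The recursive scheme shared by all the definitions, for the pair `(L, K)` on the vertex set `V`:
either `L` is a single vertex, or `K = ∅`, or the condition `P` (existence of a map) holds and all
pairs `(L \ {i}, K \ {i})` on `V \ {i}` again satisfy the definition. -/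
inductive GolodScheme
    (P : Finset ι → PreAbstractSimplicialComplex ι → PreAbstractSimplicialComplex ι → Prop) :
    Finset ι → PreAbstractSimplicialComplex ι → PreAbstractSimplicialComplex ι → Prop
  | single (V : Finset ι) (L K : PreAbstractSimplicialComplex ι) (v : ι)
      (hL : L.faces = {{v}}) : GolodScheme P V L K
  | empty (V : Finset ι) (L K : PreAbstractSimplicialComplex ι) (hK : K = ⊥) :
      GolodScheme P V L K
  | step (V : Finset ι) (L K : PreAbstractSimplicialComplex ι)
      (hrec : ∀ i ∈ V,
        GolodScheme P (V.erase i) (restrict L (V.erase i)) (restrict K (V.erase i)))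
      (hmap : P V L K) : GolodScheme P V L K

/-- First definition of coherent homotopy Golodness. -/
def CoherentlyGolod1 :
    Finset ι → PreAbstractSimplicialComplex ι → PreAbstractSimplicialComplex ι → Prop :=
  GolodScheme HasMap1

/-- Second definition of coherent homotopy Golodness. -/
def CoherentlyGolod2 :
    Finset ι → PreAbstractSimplicialComplex ι → PreAbstractSimplicialComplex ι → Prop :=
  GolodScheme fun V L K => ∃ e : Fin V.card ≃ V, HasMap2 V e L K

/-- Third definition of coherent homotopy Golodness. -/
def CoherentlyGolod3 :
    Finset ι → PreAbstractSimplicialComplex ι → PreAbstractSimplicialComplex ι → Prop :=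
  GolodScheme fun V L K => ∃ e : Fin V.card ≃ V, HasMap3 V e L K

/-- A choice of a vertex ordering of every finite vertex set occurring in the recursion; for
example, all those induced by one total order. -/
abbrev VertexOrdering (ι : Type u) : Type u := ∀ V : Finset ι, Fin V.card ≃ V

/-- The second definition with respect to prescribed vertex orderings. -/
def CoherentlyGolod2With (o : VertexOrdering ι) :
    Finset ι → PreAbstractSimplicialComplex ι → PreAbstractSimplicialComplex ι → Prop :=
  GolodScheme fun V L K => HasMap2 V (o V) L K

/-- The third definition with respect to prescribed vertex orderings. -/
def CoherentlyGolod3With (o : VertexOrdering ι) :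
    Finset ι → PreAbstractSimplicialComplex ι → PreAbstractSimplicialComplex ι → Prop :=
  GolodScheme fun V L K => HasMap3 V (o V) L K

/-- `(L, K)` is a pair of complexes on the vertex set `V`: `K` is a subcomplex of `L`, and `L` has no
ghost vertices. -/
structure IsPairOn (V : Finset ι) (L K : PreAbstractSimplicialComplex ι) : Prop where
  le : K ≤ L
  faces_subset : ∀ σ ∈ L.faces, σ ⊆ V
  vertex_mem : ∀ v ∈ V, {v} ∈ L.faces

end Complexes

end CoherentGolod

/-! The second and third definitions differ by a change of coordinates. A point `(t, p)` of
`Σ|Δ^{n-1}|` is sent to the point of the cube at sup distance `1 - t` from the corner `(1, …, 1)`,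
in the direction `-p`. This induces a homeomorphism onto `(D¹)^{∧n}`. Barycentric coordinates that
vanish become cube coordinates equal to `1`, so `Σ|M|` goes onto the image of `(D¹, S⁰)^M` for every
complex `M`. The smash product of the `Ŵ'_{I_j}` is the image of the polyhedral product of the join
(`setOf_parts_eq_polyProd`), so both conditions on the map correspond (`hasMap2_iff_hasMap3`).

For the first and second definitions, `|𝒦_n|` is identified with the functions `V → [0,1]` of
minimum `0` and maximum `1`: barycentric coordinates are the gaps between successive values, and the
parts are the level sets at interior points of a simplex (`partitionHomeo`). Subtracting the value
at the last vertex turns such a function into a direction in `ℝ^{n-1}`, so that `[-1,1]^{n-1}` is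
the cone on `|𝒦_n|` with apex `0` (`ray`). The cone parameter of the first definition becomes the
radius in the second. Away from the center the level sets are unchanged, and at the center the
condition holds because `K ⊆ L`. Passing to faces is harmless, since a finer partition has a larger
join (`suspJoin_mono`).

This needs at least two vertices; smaller pairs fall under the base clauses of the recursion. The
first definition mentions no ordering, which gives independence of the orderings in the other two.
-/

namespace CoherentGolod

open Topology

/-! ### Maps out of collapsed spaces and suspensions -/

section Quotients

variable {X Y Z : Type*}

theorem Collapse.mk_eq_base {A : Set X} {x : X} (hx : x ∈ A) :
    Collapse.mk A x = Collapse.base A :=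
  Quotient.sound (Or.inr ⟨Or.inl ⟨x, hx, rfl⟩, Or.inr rfl⟩)

theorem Collapse.ind {A : Set X} {motive : Collapse A → Prop} (mk : ∀ x, motive (Collapse.mk A x))
    (base : motive (Collapse.base A)) (c : Collapse A) : motive c := by
  induction c using Quotient.inductionOn with
  | _ p =>
    rcases p with x | ⟨⟩
    · exact mk x
    · exact base

/-- The map out of `X / A` given by a map on `X` which is constant on `A`. -/
def Collapse.lift {A : Set X} (f : X → Z) (z : Z) (h : ∀ x ∈ A, f x = z) : Collapse A → Z :=
  Quotient.lift (Sum.elim f fun _ => z) (by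
    have key : ∀ p : X ⊕ Unit, p ∈ Sum.inl '' A ∪ {Sum.inr ()} →
        Sum.elim f (fun _ => z) p = z := by
      rintro p (⟨x, hx, rfl⟩ | rfl)
      · exact h x hx
      · rfl
    rintro p q (rfl | ⟨hp, hq⟩)
    · rfl
    · rw [key p hp, key q hq])

theorem Susp.map_id : Susp.map (id : X → X) = id := by
  funext p
  induction p using Quot.ind with
  | _ p => rcases p with ⟨t, x⟩ | b <;> rfl

/-- The point `(t, x)` of the unreduced suspension. -/
def Susp.mk (t : D1) (x : X) : Susp X := Quot.mk _ (Sum.inl (t, x))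

/-- The tip `*₁` of the unreduced suspension. -/
def Susp.north (X : Type*) : Susp X := Quot.mk _ (Sum.inr true)

theorem Susp.mk_eq_base {t : D1} (ht : (t : ℝ) = -1) (x : X) : Susp.mk t x = Susp.base X :=
  Quot.sound (SuspRel.south t x ht)

theorem Susp.mk_eq_north {t : D1} (ht : (t : ℝ) = 1) (x : X) : Susp.mk t x = Susp.north X :=
  Quot.sound (SuspRel.north t x ht)

/-- Every point of a suspension is a tip or lies at a height strictly between the tips. -/
theorem Susp.ind {motive : Susp X → Prop} (base : motive (Susp.base X))
    (north : motive (Susp.north X))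
    (mk : ∀ (t : D1) (x : X), -1 < (t : ℝ) → (t : ℝ) < 1 → motive (Susp.mk t x)) (p : Susp X) :
    motive p := by
  induction p using Quot.ind with
  | _ p =>
    rcases p with ⟨t, x⟩ | b
    · change motive (Susp.mk t x)
      rcases eq_or_lt_of_le t.2.1 with h | h
      · rw [Susp.mk_eq_base h.symm]; exact base
      · rcases eq_or_lt_of_le t.2.2 with h' | h'
        · rw [Susp.mk_eq_north h']; exact north
        · exact mk t x h h'
    · cases b
      · exact base
      · exact north

variable [TopologicalSpace X] [TopologicalSpace Y] [TopologicalSpace Z]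

theorem Collapse.continuous_mk (A : Set X) : Continuous (Collapse.mk A) :=
  continuous_quot_mk.comp continuous_inl

theorem Collapse.continuous_lift {A : Set X} {f : X → Z} {z : Z} (h : ∀ x ∈ A, f x = z)
    (hf : Continuous f) : Continuous (Collapse.lift f z h) :=
  Continuous.quotient_lift (hf.sumElim continuous_const) _

theorem Susp.continuous_map {f : X → Y} (hf : Continuous f) : Continuous (Susp.map f) :=
  continuous_quot_lift _
    (continuous_quot_mk.comp (Continuous.sumMap (continuous_id.prodMap hf) continuous_id))

instance [CompactSpace X] : CompactSpace (Susp X) :=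
  inferInstanceAs (CompactSpace (Quot (SuspRel X)))

/-- The map of reduced suspensions induced by a pointed map. -/
def RedSusp.map (m : ℕ) {x₀ : X} {y₀ : Y} (f : C(X, Y)) (hf : f x₀ = y₀) :
    C(RedSusp m x₀, RedSusp m y₀) where
  toFun := Collapse.lift (fun p => Collapse.mk _ (p.1, f p.2)) (Collapse.base _) (by
    rintro ⟨y, x⟩ (h | h)
    · exact Collapse.mk_eq_base (Or.inl h)
    · refine Collapse.mk_eq_base (Or.inr ?_)
      change f x = y₀
      rw [← hf]
      exact congrArg f h)
  continuous_toFun := Collapse.continuous_lift _ ((Collapse.continuous_mk _).comp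
    (continuous_fst.prodMk (f.continuous.comp continuous_snd)))

end Quotients

/-! ### The suspended simplex is a smash power of the interval -/

section SuspensionOfSimplex

variable {V : Type*} [Fintype V]

/-- The product `d` of the `1 + x v` vanishes exactly on the fat wedge. Hence `x ↦ (d x, d x • x)`
collapses the fat wedge to `0` and is injective off it, which embeds the quotient injectively in a
Hausdorff space. -/
instance : T2Space (Smash V) := by
  classical
  let d : (V → D1) → ℝ := fun x => ∏ v, (1 + (x v : ℝ))
  have hd : ∀ x ∈ fatWedge V, d x = 0 := by
    rintro x ⟨v, hv⟩
    exact Finset.prod_eq_zero (Finset.mem_univ v) (by rw [hv]; norm_num)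
  have hd' : ∀ x, d x = 0 → x ∈ fatWedge V := by
    intro x hx
    obtain ⟨v, -, hv⟩ := Finset.prod_eq_zero_iff.1 hx
    exact ⟨v, by linarith⟩
  have hdc : Continuous d := by fun_prop
  let F : Smash V → ℝ × (V → ℝ) :=
    Collapse.lift (fun x => (d x, fun v => d x * (x v : ℝ))) 0 (by
      intro x hx
      ext <;> simp [hd x hx])
  have hF : Continuous F := Collapse.continuous_lift _ (by fun_prop)
  refine T2Space.of_injective_continuous (f := F) ?_ hF
  have aux : ∀ x, F (Collapse.mk _ x) = 0 → x ∈ fatWedge V := fun x hx =>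
    hd' x (congrArg Prod.fst hx)
  intro p q hpq
  induction p using Collapse.ind with
  | base =>
    induction q using Collapse.ind with
    | base => rfl
    | mk y => exact (Collapse.mk_eq_base (aux y hpq.symm)).symm
  | mk x =>
    induction q using Collapse.ind with
    | base => exact Collapse.mk_eq_base (aux x hpq)
    | mk y =>
      have h1 : d x = d y := congrArg Prod.fst hpq
      by_cases h0 : d x = 0
      · rw [Collapse.mk_eq_base (hd' x h0), Collapse.mk_eq_base (hd' y (h1 ▸ h0))]
      · congr 1
        funext v
        have h2 : d x * (x v : ℝ) = d y * (y v : ℝ) := congrFun (congrArg Prod.snd hpq) v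
        rw [← h1] at h2
        exact Subtype.ext (mul_left_cancel₀ h0 h2)

/-- The sup norm of a vector is the absolute value of one of its coordinates. -/
theorem exists_abs_eq_norm [Nonempty V] (p : V → ℝ) : ∃ v, |p v| = ‖p‖ := by
  obtain ⟨v, hv⟩ := Finite.exists_max fun v => ‖p v‖
  exact ⟨v, le_antisymm (norm_le_pi_norm p v) ((pi_norm_le_iff_of_nonempty p).2 hv)⟩

theorem norm_stdSimplex_pos (p : stdSimplex ℝ V) : 0 < ‖(p : V → ℝ)‖ := by
  rw [norm_pos_iff]
  intro h
  have := stdSimplex.sum_eq_one p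
  simp [h] at this

theorem nonempty_of_stdSimplex (p : stdSimplex ℝ V) : Nonempty V := by
  by_contra h
  rw [not_nonempty_iff] at h
  have := p.2.2
  rw [Finset.univ_eq_empty, Finset.sum_empty] at this
  exact zero_ne_one this

/-- The point of the cube which lies in the direction `p` from the corner `(1, …, 1)` and has
smallest coordinate `t`. -/
noncomputable def cubePoint (t : D1) (p : stdSimplex ℝ V) : V → D1 := fun v =>
  ⟨1 - (1 - t) * ((p : V → ℝ) v / ‖(p : V → ℝ)‖), by
    have h0 := p.2.1 v
    have h1 : (p : V → ℝ) v ≤ ‖(p : V → ℝ)‖ := (le_abs_self _).trans (norm_le_pi_norm (⇑p) v)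
    have h2 := norm_stdSimplex_pos p
    have h3 : 0 ≤ (p : V → ℝ) v / ‖(p : V → ℝ)‖ := by positivity
    have h4 : (p : V → ℝ) v / ‖(p : V → ℝ)‖ ≤ 1 := (div_le_one h2).2 h1
    have h5 := t.2.1
    have h6 := t.2.2
    constructor <;> nlinarith⟩

theorem continuous_cubePoint : Continuous fun q : D1 × stdSimplex ℝ V => cubePoint q.1 q.2 := by
  refine continuous_pi fun v => Continuous.subtype_mk ?_ _
  refine continuous_const.sub ((by fun_prop : Continuous _).mul (Continuous.div ?_ ?_ ?_))
  · exact (continuous_apply v).comp (continuous_subtype_val.comp continuous_snd)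
  · exact (continuous_subtype_val.comp continuous_snd).norm
  · exact fun q => (norm_stdSimplex_pos q.2).ne'

theorem one_sub_cubePoint (t : D1) (p : stdSimplex ℝ V) :
    (fun v => 1 - (cubePoint t p v : ℝ)) = ((1 - (t : ℝ)) / ‖(p : V → ℝ)‖) • (p : V → ℝ) := by
  funext v
  simp [cubePoint]
  ring

theorem norm_one_sub_cubePoint (t : D1) (p : stdSimplex ℝ V) :
    ‖fun v => 1 - (cubePoint t p v : ℝ)‖ = 1 - t := by
  have h := norm_stdSimplex_pos p
  have h6 := t.2.2
  rw [one_sub_cubePoint, norm_smul, Real.norm_eq_abs, abs_of_nonneg (by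
    apply div_nonneg _ h.le; linarith), div_mul_cancel₀ _ h.ne']

theorem sum_one_sub_cubePoint (t : D1) (p : stdSimplex ℝ V) :
    ∑ v, (1 - (cubePoint t p v : ℝ)) = (1 - (t : ℝ)) / ‖(p : V → ℝ)‖ := by
  have h : ∀ v, 1 - (cubePoint t p v : ℝ) = ((1 - (t : ℝ)) / ‖(p : V → ℝ)‖) * (p : V → ℝ) v :=
    fun v => congrFun (one_sub_cubePoint t p) v
  rw [Finset.sum_congr rfl fun v _ => h v, ← Finset.mul_sum, stdSimplex.sum_eq_one, mul_one]

/-- A coordinate equals `-1` exactly when the displacement from the corner `(1, …, 1)` has sup norm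
`2`, and this norm is `1 - t`. -/
theorem cubePoint_mem_fatWedge_iff (t : D1) (p : stdSimplex ℝ V) :
    cubePoint t p ∈ fatWedge V ↔ (t : ℝ) = -1 := by
  have := nonempty_of_stdSimplex p
  constructor
  · rintro ⟨v, hv⟩
    have h := norm_le_pi_norm (fun v => 1 - (cubePoint t p v : ℝ)) v
    rw [norm_one_sub_cubePoint, hv] at h
    norm_num at h
    exact le_antisymm (by linarith) t.2.1
  · intro ht
    obtain ⟨v, hv⟩ := exists_abs_eq_norm fun v => 1 - (cubePoint t p v : ℝ)
    rw [norm_one_sub_cubePoint, abs_of_nonneg (by linarith [(cubePoint t p v).2.2])] at hv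
    exact ⟨v, by linarith⟩

theorem cubePoint_of_eq_one {t : D1} (ht : (t : ℝ) = 1) (p : stdSimplex ℝ V) :
    cubePoint t p = fun _ => ⟨1, by norm_num⟩ := by
  funext v
  ext
  simp [cubePoint, ht]

/-- The sup norm of the displacement from the corner recovers `t`. Its coordinate sum recovers the
factor by which `p` was scaled; for `t < 1` that factor is nonzero and can be cancelled. -/
theorem cubePoint_injective {t t' : D1} {p p' : stdSimplex ℝ V} (ht : (t : ℝ) < 1)
    (h : cubePoint t p = cubePoint t' p') : t = t' ∧ p = p' := by
  have h1 := norm_one_sub_cubePoint t p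
  have h2 := sum_one_sub_cubePoint t p
  have h3 := one_sub_cubePoint t p
  rw [h, norm_one_sub_cubePoint] at h1
  rw [h, sum_one_sub_cubePoint] at h2
  rw [h, one_sub_cubePoint, h2] at h3
  refine ⟨Subtype.ext (by linarith), Subtype.ext ?_⟩
  have hpos : (1 - (t : ℝ)) / ‖(p : V → ℝ)‖ ≠ 0 :=
    (div_pos (by linarith) (norm_stdSimplex_pos p)).ne'
  exact (smul_right_injective _ hpos h3).symm

/-- The displacement `u` from the corner is nonzero; dividing it by its coordinate sum gives `p`,
and `t = 1 - ‖u‖`. The clause on vanishing coordinates is what later places `p` in a given face. -/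
theorem exists_cubePoint_eq (x : V → D1) (hx : ∃ v, (x v : ℝ) ≠ 1) :
    ∃ (t : D1) (p : stdSimplex ℝ V), cubePoint t p = x ∧ ∀ v, (x v : ℝ) = 1 → p v = 0 := by
  let u : V → ℝ := fun v => 1 - (x v : ℝ)
  have hu0 : ∀ v, 0 ≤ u v := fun v => by linarith [(x v).2.2]
  have hu2 : ‖u‖ ≤ 2 := (pi_norm_le_iff_of_nonneg (by norm_num)).2 fun v => by
    rw [Real.norm_eq_abs, abs_of_nonneg (hu0 v)]
    linarith [(x v).2.1]
  obtain ⟨v, hv⟩ := hx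
  have huv : 0 < u v := lt_of_le_of_ne (hu0 v) fun h => hv (by linarith)
  have hs : 0 < ∑ v, u v := Finset.sum_pos' (fun v _ => hu0 v) ⟨v, Finset.mem_univ v, huv⟩
  have hn : 0 < ‖u‖ := norm_pos_iff.2 fun h => huv.ne' (congrFun h v)
  let p : stdSimplex ℝ V := ⟨(∑ v, u v)⁻¹ • u, fun v => mul_nonneg (inv_pos.2 hs).le (hu0 v), by
    simp only [Pi.smul_apply, smul_eq_mul]
    rw [← Finset.mul_sum, inv_mul_cancel₀ hs.ne']⟩
  refine ⟨⟨1 - ‖u‖, by linarith, by linarith⟩, p, ?_, ?_⟩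
  · funext v
    ext
    have hpn : ‖(p : V → ℝ)‖ = (∑ v, u v)⁻¹ * ‖u‖ := by
      change ‖(∑ v, u v)⁻¹ • u‖ = _
      rw [norm_smul, Real.norm_eq_abs, abs_of_pos (inv_pos.2 hs)]
    change 1 - (1 - (1 - ‖u‖)) * (((∑ v, u v)⁻¹ * u v) / ‖(p : V → ℝ)‖) = (x v : ℝ)
    have : ‖u‖ * (((∑ v, u v)⁻¹ * u v) / ((∑ v, u v)⁻¹ * ‖u‖)) = u v := by
      field_simp
    rw [hpn, sub_sub_cancel, this]
    simp [u]
  · intro v hv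
    change (∑ v, u v)⁻¹ * u v = 0
    simp [u, hv]

/-- The comparison map `Σ|Δ^{n-1}| → (D¹)^{∧n}`. -/
noncomputable def suspToSmash (V : Type*) [Fintype V] : Susp (stdSimplex ℝ V) → Smash V :=
  Quot.lift (Sum.elim (fun q => Collapse.mk _ (cubePoint q.1 q.2))
    fun b => if b then Collapse.mk _ fun _ => ⟨1, by norm_num⟩ else Collapse.base _) (by
      rintro _ _ (⟨t, x, ht⟩ | ⟨t, x, ht⟩)
      · exact Collapse.mk_eq_base ((cubePoint_mem_fatWedge_iff t x).2 ht)
      · exact congrArg (Collapse.mk _) (cubePoint_of_eq_one ht x))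

theorem continuous_suspToSmash : Continuous (suspToSmash V) :=
  continuous_quot_lift _
    (((Collapse.continuous_mk _).comp continuous_cubePoint).sumElim continuous_of_discreteTopology)

theorem Collapse.mk_eq_mk {X : Type*} {A : Set X} {x y : X}
    (h : Collapse.mk A x = Collapse.mk A y) : x = y ∨ x ∈ A ∧ y ∈ A := by
  rcases Quotient.exact h with h | ⟨h, h'⟩
  · exact Or.inl (Sum.inl_injective h)
  · exact Or.inr ⟨by simpa using h, by simpa using h'⟩

theorem Collapse.mk_eq_base_iff {X : Type*} {A : Set X} {x : X} :
    Collapse.mk A x = Collapse.base A ↔ x ∈ A := by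
  refine ⟨fun h => ?_, Collapse.mk_eq_base⟩
  rcases Quotient.exact h with h | ⟨h, -⟩
  · cases h
  · simpa using h

/-- Stated for an arbitrary injection `f`, to serve both for the identity of the simplex and for the
inclusion of `|M|`. -/
theorem suspToSmash_map_injective {A : Type*} {f : A → stdSimplex ℝ V}
    (hf : Function.Injective f) : Function.Injective (suspToSmash V ∘ Susp.map f) := by
  have key : ∀ (t : D1) (a : A) (t' : D1) (p' : stdSimplex ℝ V), -1 < (t : ℝ) → (t : ℝ) < 1 →
      Collapse.mk (fatWedge V) (cubePoint t (f a)) = Collapse.mk _ (cubePoint t' p') →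
        t = t' ∧ f a = p' := by
    intro t a t' p' h1 h2 h
    rcases Collapse.mk_eq_mk h with h | ⟨h, -⟩
    · exact cubePoint_injective h2 h
    · exact absurd ((cubePoint_mem_fatWedge_iff _ _).1 h) h1.ne'
  have hbase : ∀ (t : D1) (a : A), -1 < (t : ℝ) →
      Collapse.mk (fatWedge V) (cubePoint t (f a)) ≠ Collapse.base _ := fun t a h1 h =>
    h1.ne' ((cubePoint_mem_fatWedge_iff _ _).1 (Collapse.mk_eq_base_iff.1 h))
  have hnorth : ∀ (t : D1) (a : A), -1 < (t : ℝ) → (t : ℝ) < 1 →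
      Collapse.mk (fatWedge V) (cubePoint t (f a)) ≠ Collapse.mk _ fun _ => ⟨1, by norm_num⟩ := by
    intro t a h1 h2 h
    -- The corner is the cube point of height `1` in any direction, so `key` applies and forces `t =
    -- 1`.
    rw [← cubePoint_of_eq_one (t := ⟨1, by norm_num⟩) rfl (f a)] at h
    have := (key t a _ _ h1 h2 h).1
    rw [this] at h2
    exact lt_irrefl _ h2
  have hbn : (Collapse.mk (fatWedge V) fun _ => ⟨1, by norm_num⟩) ≠ Collapse.base _ := by
    intro h
    obtain ⟨v, hv⟩ := Collapse.mk_eq_base_iff.1 h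
    norm_num at hv
  intro p q hpq
  induction p using Susp.ind with
  | base =>
    induction q using Susp.ind with
    | base => rfl
    | north => exact absurd hpq.symm hbn
    | mk t a h1 h2 => exact absurd hpq.symm (hbase t a h1)
  | north =>
    induction q using Susp.ind with
    | base => exact absurd hpq hbn
    | north => rfl
    | mk t a h1 h2 => exact absurd hpq.symm (hnorth t a h1 h2)
  | mk t a h1 h2 =>
    induction q using Susp.ind with
    | base => exact absurd hpq (hbase t a h1)
    | north => exact absurd hpq (hnorth t a h1 h2)
    | mk t' a' h1' h2' =>
      obtain ⟨h, h'⟩ := key t a t' (f a') h1 h2 hpq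
      rw [h, hf h']

theorem suspToSmash_bijective : Function.Bijective (suspToSmash V) := by
  constructor
  · have := suspToSmash_map_injective (V := V) (f := id) Function.injective_id
    rwa [Susp.map_id, Function.comp_id] at this
  · intro c
    induction c using Collapse.ind with
    | base => exact ⟨Susp.base _, rfl⟩
    | mk x =>
      by_cases hx : ∃ v, (x v : ℝ) ≠ 1
      · obtain ⟨t, p, h, -⟩ := exists_cubePoint_eq x hx
        exact ⟨Susp.mk t p, congrArg (Collapse.mk _) h⟩
      · push Not at hx
        refine ⟨Susp.north _, congrArg (Collapse.mk _) ?_⟩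
        funext v
        exact Subtype.ext (hx v).symm

/-- The homeomorphism `Σ|Δ^{n-1}| ≅ (D¹)^{∧n}`. -/
noncomputable def suspHomeoSmash (V : Type*) [Fintype V] : Susp (stdSimplex ℝ V) ≃ₜ Smash V :=
  Continuous.homeoOfEquivCompactToT2 (f := Equiv.ofBijective _ (suspToSmash_bijective (V := V)))
    continuous_suspToSmash

end SuspensionOfSimplex

/-! ### Suspended complexes and polyhedral products; the second and third definitions -/

section Complexes

variable {ι : Type*} {V : Finset ι}

/-- A finite union of closed faces. The union is indexed by subsets of `V`, because `M` may have
infinitely many faces when they are not confined to `V`. -/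
instance (M : PreAbstractSimplicialComplex ι) : CompactSpace (realization V M) := by
  classical
  rw [← isCompact_iff_compactSpace]
  have h : realization V M = ⋃ T ∈ {T : Finset V | T.map (Function.Embedding.subtype _) ∈ M.faces},
      {x : stdSimplex ℝ V | ∀ v, v ∉ T → x v = 0} := by
    ext x
    simp only [Set.mem_iUnion, Set.mem_ofPred_eq, exists_prop]
    constructor
    · rintro ⟨σ, hσ, h⟩
      refine ⟨Finset.univ.filter fun v : V => (v : ι) ∈ σ,
        (M.isRelLowerSet_faces hσ).2 ?_ ?_, fun v hv => h v (by simpa using hv)⟩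
      · intro v hv
        simp only [Finset.mem_map, Finset.mem_filter] at hv
        obtain ⟨w, ⟨-, hw⟩, rfl⟩ := hv
        exact hw
      -- A face disjoint from `V` would make all barycentric coordinates zero, but their sum is `1`.
      · by_contra hne
        simp only [Finset.not_nonempty_iff_eq_empty, Finset.map_eq_empty,
          Finset.filter_eq_empty_iff, Finset.mem_univ, true_implies] at hne
        have := stdSimplex.sum_eq_one x
        rw [Finset.sum_eq_zero fun v _ => h v (hne (x := v))] at this
        exact zero_ne_one this
    · rintro ⟨T, hT, h⟩
      exact ⟨_, hT, fun v hv => h v fun h' => hv (by simpa using h')⟩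
  rw [h]
  refine (Set.Finite.isClosed_biUnion (Set.toFinite _) fun T _ => ?_).isCompact
  simp only [Set.ofPred_forall]
  refine isClosed_iInter fun v => isClosed_iInter fun _ => isClosed_eq ?_ continuous_const
  exact (continuous_apply v).comp continuous_subtype_val

theorem suspToSmash_suspIncl_mem_hat (M : PreAbstractSimplicialComplex ι)
    (x : Susp (realization V M)) : suspToSmash V (suspIncl V M x) ∈ hat (polyProd V M) := by
  induction x using Susp.ind with
  | base => exact Or.inl rfl
  | north => exact Or.inr ⟨_, ⟨∅, Or.inl rfl, fun v _ => Or.inr rfl⟩, rfl⟩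
  | mk t p _ _ =>
    obtain ⟨σ, hσ, h⟩ := p.2
    refine Or.inr ⟨cubePoint t p, ⟨σ, Or.inr hσ, fun v hv => Or.inr ?_⟩, rfl⟩
    have : ((p : stdSimplex ℝ V) : V → ℝ) v = 0 := h v hv
    simp [cubePoint, this]

/-- A coordinate `-1` already means the basepoint, so a remaining point has coordinate `1` at every
vertex outside `σ`; its direction from the corner is then supported on `σ`. -/
theorem exists_suspToSmash_suspIncl_eq (M : PreAbstractSimplicialComplex ι) (y : Smash V)
    (hy : y ∈ hat (polyProd V M)) : ∃ x, suspToSmash V (suspIncl V M x) = y := by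
  rcases hy with rfl | ⟨x, ⟨σ, hσ, h⟩, rfl⟩
  · exact ⟨Susp.base _, rfl⟩
  by_cases hw : x ∈ fatWedge V
  · exact ⟨Susp.base _, (Collapse.mk_eq_base hw).symm⟩
  have h1 : ∀ v : V, (v : ι) ∉ σ → (x v : ℝ) = 1 := fun v hv =>
    (h v hv).resolve_left fun h' => hw ⟨v, h'⟩
  by_cases hx : ∃ v, (x v : ℝ) ≠ 1
  · obtain ⟨t, p, rfl, hp⟩ := exists_cubePoint_eq x hx
    have hσ' : σ ∈ M.faces := hσ.resolve_left fun h0 => by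
      obtain ⟨v, hv⟩ := hx
      exact hv (h1 v (by simp [h0]))
    exact ⟨Susp.mk t ⟨p, σ, hσ', fun v hv => hp v (h1 v hv)⟩, rfl⟩
  · push Not at hx
    refine ⟨Susp.north _, congrArg (Collapse.mk _) ?_⟩
    funext v
    exact Subtype.ext (hx v).symm

theorem continuous_suspIncl (M : PreAbstractSimplicialComplex ι) :
    Continuous (suspIncl V M) :=
  Susp.continuous_map continuous_subtype_val

/-- The homeomorphism `Σ|M| ≅ Ŵ`, where `W = (D¹, S⁰)^M`. -/
noncomputable def suspHomeoHat (V : Finset ι) (M : PreAbstractSimplicialComplex ι) :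
    Susp (realization V M) ≃ₜ hat (polyProd V M) :=
  Continuous.homeoOfEquivCompactToT2
    (f := Equiv.ofBijective
      (fun x => (⟨suspToSmash V (suspIncl V M x), suspToSmash_suspIncl_mem_hat M x⟩ :
        hat (polyProd V M)))
      ⟨fun _ _ h => suspToSmash_map_injective Subtype.val_injective (congrArg Subtype.val h),
        fun y => by
          obtain ⟨x, hx⟩ := exists_suspToSmash_suspIncl_eq M y.1 y.2
          exact ⟨x, Subtype.ext hx⟩⟩)
    (Continuous.subtype_mk (continuous_suspToSmash.comp (continuous_suspIncl M)) _)

theorem coe_suspHomeoHat (M : PreAbstractSimplicialComplex ι) (x : Susp (realization V M)) :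
    (suspHomeoHat V M x : Smash V) = suspHomeoSmash V (suspIncl V M x) := rfl

theorem suspIncl_suspHomeoHat_symm (M : PreAbstractSimplicialComplex ι)
    (x : hat (polyProd V M)) :
    suspIncl V M ((suspHomeoHat V M).symm x) = (suspHomeoSmash V).symm x := by
  rw [Homeomorph.eq_symm_apply, ← coe_suspHomeoHat, Homeomorph.apply_symm_apply]

theorem suspHomeoHat_base (M : PreAbstractSimplicialComplex ι) :
    suspHomeoHat V M (Susp.base _) = hatBase (polyProd V M) := rfl

variable [DecidableEq ι]

/-- A face of the join is a union of faces of `L`, one at most in each part, and these can be chosen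
independently of each other. -/
theorem setOf_parts_eq_polyProd {m : ℕ} (L : PreAbstractSimplicialComplex ι)
    (S : OrderedPartition V m) :
    {x : V → D1 | ∀ j, ∃ w ∈ polyProd V L, ∀ v : V, (v : ι) ∈ S.parts j → x v = w v} =
      polyProd V (partitionJoin L S) := by
  ext x
  constructor
  · intro h
    choose w hw hx using h
    choose σ hσ hσw using hw
    refine ⟨Finset.univ.biUnion fun j => σ j ∩ S.parts j, ?_, ?_⟩
    · rcases (Finset.univ.biUnion fun j => σ j ∩ S.parts j).eq_empty_or_nonempty with h | h
      · exact Or.inl h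
      · refine Or.inr ⟨h, _, fun j => ?_, rfl⟩
        rcases (σ j ∩ S.parts j).eq_empty_or_nonempty with h0 | h0
        · exact Or.inl h0
        · have hj : σ j ∈ L.faces := (hσ j).resolve_left fun h' => by simp [h'] at h0
          exact Or.inr ⟨(L.isRelLowerSet_faces hj).2 Finset.inter_subset_left h0,
            Finset.inter_subset_right⟩
    · intro v hv
      have hvV : (v : ι) ∈ Finset.univ.biUnion S.parts := S.cover.symm ▸ v.2
      obtain ⟨j, -, hj⟩ := Finset.mem_biUnion.1 hvV
      rw [hx j v hj]
      refine hσw j v fun h => hv ?_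
      exact Finset.mem_biUnion.2 ⟨j, Finset.mem_univ j, Finset.mem_inter.2 ⟨h, hj⟩⟩
  · rintro ⟨σ, hσ, hx⟩ j
    -- Coordinates outside the part are filled with `1 ∈ S⁰`, so they impose no condition on the
    -- face.
    refine ⟨fun v => if (v : ι) ∈ S.parts j then x v else ⟨1, by norm_num⟩,
      ⟨σ ∩ S.parts j, ?_, ?_⟩, fun v hv => by simp [hv]⟩
    · rcases hσ with rfl | ⟨-, τ, hτ, rfl⟩
      · simp
      · have hsub : ∀ k, τ k ⊆ S.parts k := fun k => by
          rcases hτ k with h | h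
          · simp [h]
          · exact h.2
        have : Finset.univ.biUnion τ ∩ S.parts j = τ j := by
          ext v
          simp only [Finset.mem_inter, Finset.mem_biUnion, Finset.mem_univ, true_and]
          refine ⟨?_, fun h => ⟨⟨j, h⟩, hsub j h⟩⟩
          rintro ⟨⟨k, hk⟩, hj⟩
          by_contra hv
          have hkj : k ≠ j := fun h => hv (h ▸ hk)
          exact Finset.disjoint_left.1 (S.disjoint k j hkj) (hsub k hk) hj
        rw [this]
        exact (hτ j).imp id fun h => h.1
    · intro v hv
      by_cases hj : (v : ι) ∈ S.parts j
      · simp only [hj, if_true]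
        exact hx v fun h => hv (Finset.mem_inter.2 ⟨h, hj⟩)
      · simp [hj]

theorem suspHomeoSmash_mem_smashJoin_iff {m : ℕ} (L : PreAbstractSimplicialComplex ι)
    (S : OrderedPartition V m) (z : Susp (stdSimplex ℝ V)) :
    suspHomeoSmash V z ∈ smashJoin L S ↔ z ∈ suspJoin L S := by
  rw [smashJoin, setOf_parts_eq_polyProd]
  constructor
  · intro h
    obtain ⟨x, hx⟩ := exists_suspToSmash_suspIncl_eq _ _ h
    exact ⟨x, (suspHomeoSmash V).injective hx⟩
  · rintro ⟨x, rfl⟩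
    exact suspToSmash_suspIncl_mem_hat _ x

/-- The maps of the second and of the third definition correspond to each other under the
homeomorphism `Σ|Δ^{n-1}| ≅ (D¹)^{∧n}`. -/
theorem hasMap2_iff_hasMap3 (e : Fin V.card ≃ V) (L K : PreAbstractSimplicialComplex ι) :
    HasMap2 V e L K ↔ HasMap3 V e L K := by
  have hbase : suspHomeoSmash V (Susp.base _) = Collapse.base _ := rfl
  constructor
  · rintro ⟨Ψ, h0, h⟩
    let g : C(hat (polyProd V K), Susp (realization V K)) := (suspHomeoHat V K).symm
    have hg : g (hatBase _) = Susp.base _ :=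
      (suspHomeoHat V K).symm_apply_apply (Susp.base _)
    refine ⟨((suspHomeoSmash V : C(Susp (stdSimplex ℝ V), Smash V)).comp Ψ).comp
      (RedSusp.map _ g hg), ?_, fun y hy => ⟨fun hy0 x => ?_, fun x => ?_⟩⟩
    · change suspHomeoSmash V (Ψ (Collapse.base _)) = _
      rw [h0, hbase]
    · change suspHomeoSmash V (Ψ (Collapse.mk _ (y, (suspHomeoHat V K).symm x))) = _
      rw [(h y hy).1 hy0, suspIncl_suspHomeoHat_symm, Homeomorph.apply_symm_apply]
    · exact (suspHomeoSmash_mem_smashJoin_iff L _ _).2 ((h y hy).2 _)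
  · rintro ⟨Ψ, h0, h⟩
    let g : C(Susp (realization V K), hat (polyProd V K)) := suspHomeoHat V K
    refine ⟨(((suspHomeoSmash V).symm : C(Smash V, Susp (stdSimplex ℝ V))).comp Ψ).comp
      (RedSusp.map _ g (suspHomeoHat_base K)), ?_, fun y hy => ⟨fun hy0 x => ?_, fun x => ?_⟩⟩
    · change (suspHomeoSmash V).symm (Ψ (Collapse.base _)) = _
      rw [h0, ← hbase, Homeomorph.symm_apply_apply]
    · change (suspHomeoSmash V).symm (Ψ (Collapse.mk _ (y, suspHomeoHat V K x))) = _
      rw [(h y hy).1 hy0, coe_suspHomeoHat, Homeomorph.symm_apply_apply]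
    · refine (suspHomeoSmash_mem_smashJoin_iff L _ _).1 ?_
      change suspHomeoSmash V ((suspHomeoSmash V).symm (Ψ (Collapse.mk _ (y, suspHomeoHat V K x))))
        ∈ _
      rw [Homeomorph.apply_symm_apply]
      exact (h y hy).2 _

end Complexes

/-! ### Cumulative sums and their compatibility with face maps -/

section CumulativeSum

/-- The sum of the entries `a i` with `i < j`. -/
noncomputable def cumSum {k : ℕ} (a : Fin k → ℝ) (j : Fin (k + 1)) : ℝ :=
  ∑ i, if i.castSucc < j then a i else 0

theorem cumSum_zero {k : ℕ} (a : Fin k → ℝ) : cumSum a 0 = 0 := by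
  simp [cumSum]

theorem cumSum_last {k : ℕ} (a : Fin k → ℝ) : cumSum a (Fin.last k) = ∑ i, a i := by
  simp [cumSum, Fin.castSucc_lt_last]

theorem cumSum_succ_sub {k : ℕ} (a : Fin k → ℝ) (i : Fin k) :
    cumSum a i.succ - cumSum a i.castSucc = a i := by
  rw [cumSum, cumSum, ← Finset.sum_sub_distrib]
  refine (Finset.sum_eq_single i (fun l _ hl => ?_) (by simp)).trans (by simp)
  have : l.castSucc < i.succ ↔ l.castSucc < i.castSucc := by
    rw [Fin.castSucc_lt_succ_iff, Fin.castSucc_lt_castSucc_iff, le_iff_lt_or_eq]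
    simp [hl]
  simp [this]

theorem cumSum_sub {k : ℕ} (c : Fin (k + 1) → ℝ) (j : Fin (k + 1)) :
    cumSum (fun i => c i.succ - c i.castSucc) j = c j - c 0 := by
  induction j using Fin.induction with
  | zero => simp [cumSum_zero]
  | succ i ih =>
    have := cumSum_succ_sub (fun i => c i.succ - c i.castSucc) i
    linarith

theorem cumSum_mono {k : ℕ} {a : Fin k → ℝ} (ha : ∀ i, 0 ≤ a i) : Monotone (cumSum a) :=
  Fin.monotone_iff_le_succ.2 fun i => by linarith [cumSum_succ_sub a i, ha i]

theorem cumSum_strictMono {k : ℕ} {a : Fin k → ℝ} (ha : ∀ i, 0 < a i) : StrictMono (cumSum a) :=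
  Fin.strictMono_iff_lt_succ.2 fun i => by linarith [cumSum_succ_sub a i, ha i]

/-- The duality between positions in a chain and the gaps between them: merging two adjacent
positions on one side corresponds to skipping the gap `p` on the other. -/
theorem castSucc_lt_predAbove_iff {k : ℕ} (p : Fin (k + 1)) (i : Fin k) (j : Fin (k + 2)) :
    i.castSucc < p.predAbove j ↔ (p.succAbove i).castSucc < j := by
  have hp := Fin.val_castSucc p
  have hi := Fin.val_castSucc i
  rcases lt_or_ge p.castSucc j with h | h
  · have h1 := Fin.lt_def.1 h
    rw [Fin.predAbove_of_castSucc_lt _ _ h]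
    rcases lt_or_ge i.castSucc p with h' | h'
    · have h2 := Fin.lt_def.1 h'
      rw [Fin.succAbove_of_castSucc_lt _ _ h']
      simp only [Fin.lt_def, Fin.val_castSucc, Fin.val_pred]
      omega
    · have h2 := Fin.le_def.1 h'
      rw [Fin.succAbove_of_le_castSucc _ _ h']
      simp only [Fin.lt_def, Fin.val_castSucc, Fin.val_pred, Fin.val_succ]
      omega
  · have h1 := Fin.le_def.1 h
    rw [Fin.predAbove_of_le_castSucc _ _ h]
    rcases lt_or_ge i.castSucc p with h' | h'
    · rw [Fin.succAbove_of_castSucc_lt _ _ h']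
      simp only [Fin.lt_def, Fin.val_castSucc, Fin.coe_castPred]
    · have h2 := Fin.le_def.1 h'
      rw [Fin.succAbove_of_le_castSucc _ _ h']
      simp only [Fin.lt_def, Fin.val_castSucc, Fin.coe_castPred, Fin.val_succ]
      omega

/-- The pushed-forward vector has a zero in gap `p`, so the two positions next to this gap have
equal cumulative sums and may be merged. This is what makes height functions respect the gluing of
`|𝒦_n|`. -/
theorem cumSum_map_succAbove {k : ℕ} (p : Fin (k + 2)) (a : stdSimplex ℝ (Fin (k + 1)))
    (j : Fin (k + 3)) :
    cumSum (stdSimplex.map p.succAbove a) j = cumSum a (p.predAbove j) := by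
  have h : ∀ l, (stdSimplex.map p.succAbove a) l = ∑ i, if p.succAbove i = l then a i else 0 := by
    intro l
    rw [stdSimplex.map_coe, FunOnFinite.linearMap_apply_apply, Finset.sum_filter]
  unfold cumSum
  simp only [h, castSucc_lt_predAbove_iff]
  calc _ = ∑ l, ∑ i, if p.succAbove i = l then (if l.castSucc < j then a i else 0) else 0 := by
        refine Finset.sum_congr rfl fun l _ => ?_
        by_cases hl : l.castSucc < j <;> simp [hl]
    _ = _ := by
        rw [Finset.sum_comm]
        simp

end CumulativeSum

/-! ### Ordered partitions and the joins they define -/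

section Partitions

variable {ι : Type*} {V : Finset ι}

theorem range_suspIncl_mono {M N : PreAbstractSimplicialComplex ι} (h : M.faces ⊆ N.faces) :
    Set.range (suspIncl V M) ⊆ Set.range (suspIncl V N) := by
  rintro _ ⟨x, rfl⟩
  have hMN : realization V M ⊆ realization V N := fun p ⟨σ, hσ, hp⟩ => ⟨σ, h hσ, hp⟩
  refine ⟨Susp.map (Set.inclusion hMN) x, ?_⟩
  induction x using Quot.ind with
  | _ p => rcases p with ⟨t, x⟩ | b <;> rfl

variable [DecidableEq ι]

theorem OrderedPartition.exists_mem_parts {m : ℕ} (S : OrderedPartition V m) (v : V) :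
    ∃ j, (v : ι) ∈ S.parts j := by
  have h : (v : ι) ∈ Finset.univ.biUnion S.parts := S.cover.symm ▸ v.2
  simpa using h

/-- The position of the part that contains `v`. -/
noncomputable def OrderedPartition.index {m : ℕ} (S : OrderedPartition V m) (v : V) : Fin m :=
  (S.exists_mem_parts v).choose

theorem OrderedPartition.mem_parts_iff {m : ℕ} (S : OrderedPartition V m) (v : V) (j : Fin m) :
    (v : ι) ∈ S.parts j ↔ S.index v = j := by
  have h : (v : ι) ∈ S.parts (S.index v) := (S.exists_mem_parts v).choose_spec
  refine ⟨fun hj => ?_, fun hj => hj ▸ h⟩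
  by_contra hne
  exact Finset.disjoint_left.1 (S.disjoint _ _ hne) h hj

theorem OrderedPartition.parts_subset {m : ℕ} (S : OrderedPartition V m) (j : Fin m) :
    S.parts j ⊆ V := fun _ hv =>
  S.cover ▸ Finset.mem_biUnion.2 ⟨j, Finset.mem_univ j, hv⟩

theorem OrderedPartition.index_surjective {m : ℕ} (S : OrderedPartition V m) :
    Function.Surjective S.index := fun j => by
  obtain ⟨v, hv⟩ := S.nonempty j
  exact ⟨⟨v, S.parts_subset j hv⟩, (S.mem_parts_iff _ _).1 hv⟩

theorem OrderedPartition.index_injective {m : ℕ} :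
    Function.Injective (OrderedPartition.index : OrderedPartition V m → V → Fin m) := by
  intro S T h
  ext j v
  by_cases hv : v ∈ V
  · rw [S.mem_parts_iff ⟨v, hv⟩, T.mem_parts_iff ⟨v, hv⟩, h]
  · exact ⟨fun h => absurd (S.parts_subset j h) hv, fun h => absurd (T.parts_subset j h) hv⟩

theorem OrderedPartition.index_face {k : ℕ} (S : OrderedPartition V (k + 1)) (i : Fin k) (v : V) :
    (S.face i).index v = i.predAbove (S.index v) := by
  rw [← OrderedPartition.mem_parts_iff]
  refine Finset.mem_biUnion.2 ⟨S.index v, by simp, (S.mem_parts_iff _ _).2 rfl⟩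

theorem OrderedPartition.length_le {m : ℕ} (S : OrderedPartition V m) : m ≤ V.card := by
  simpa using Fintype.card_le_of_surjective _ S.index_surjective

instance (m : ℕ) : Finite (OrderedPartition V m) :=
  Finite.of_injective _ OrderedPartition.index_injective

/-- Nonempty disjoint parts bound the length by `V.card`. Finiteness makes `|𝒦_n|` compact. -/
instance : Finite (Σ k : ℕ, OrderedPartition V (k + 2)) := by
  let f : (Σ k : Fin (V.card + 1), OrderedPartition V (k + 2)) →
      Σ k : ℕ, OrderedPartition V (k + 2) := fun S => ⟨S.1, S.2⟩
  refine Finite.of_surjective f ?_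
  rintro ⟨k, S⟩
  exact ⟨⟨⟨k, by have := S.length_le; omega⟩, S⟩, rfl⟩

theorem index_levelPartition_eq_iff (s : V → ℝ) (v : V) (j : Fin (Finset.univ.image s).card) :
    (levelPartition s).index v = j ↔ s v = (Finset.univ.image s).orderEmbOfFin rfl j := by
  rw [← OrderedPartition.mem_parts_iff]
  constructor
  · intro h
    obtain ⟨w, hw, hwv⟩ := Finset.mem_map.1 h
    obtain rfl : w = v := Subtype.ext hwv
    exact (Finset.mem_filter.1 hw).2
  · exact fun h => Finset.mem_map.2 ⟨v, Finset.mem_filter.2 ⟨Finset.mem_univ v, h⟩, rfl⟩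

theorem index_levelPartition_eq_index_iff (s : V → ℝ) (v w : V) :
    (levelPartition s).index v = (levelPartition s).index w ↔ s v = s w := by
  rw [index_levelPartition_eq_iff, ← (index_levelPartition_eq_iff s w _).1 rfl]

theorem mem_partitionJoin {m : ℕ} {L : PreAbstractSimplicialComplex ι} (S : OrderedPartition V m)
    {σ : Finset ι} (hne : σ.Nonempty) (hσ : σ ⊆ V)
    (h : ∀ j, (σ ∩ S.parts j).Nonempty → σ ∩ S.parts j ∈ L.faces) :
    σ ∈ (partitionJoin L S).faces := by
  refine ⟨hne, fun j => σ ∩ S.parts j, fun j => ?_, ?_⟩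
  · rcases (σ ∩ S.parts j).eq_empty_or_nonempty with h0 | h0
    · exact Or.inl h0
    · exact Or.inr ⟨h j h0, Finset.inter_subset_right⟩
  · rw [← Finset.inter_biUnion, S.cover, Finset.inter_eq_left.2 hσ]

/-- This settles the center of the cube, where the map is the inclusion of `Σ|K|`: a face of `K` is
a face of `L`, and so are its nonempty intersections with the parts. -/
theorem range_suspIncl_subset_suspJoin {L K : PreAbstractSimplicialComplex ι}
    (hLK : IsPairOn V L K) {m : ℕ} (S : OrderedPartition V m) :
    Set.range (suspIncl V K) ⊆ suspJoin L S := by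
  refine range_suspIncl_mono fun σ hσ => ?_
  have hL : σ ∈ L.faces := hLK.le hσ
  exact mem_partitionJoin S (L.isRelLowerSet_faces hL).1 (hLK.faces_subset σ hL)
    fun j hj => (L.isRelLowerSet_faces hL).2 Finset.inter_subset_left hj

/-- Refining an ordered partition enlarges the join. -/
theorem suspJoin_mono (L : PreAbstractSimplicialComplex ι) {m m' : ℕ} (S : OrderedPartition V m)
    (T : OrderedPartition V m') (h : ∀ v w, S.index v = S.index w → T.index v = T.index w) :
    suspJoin L T ⊆ suspJoin L S := by
  refine range_suspIncl_mono ?_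
  rintro σ ⟨hne, τ, hτ, rfl⟩
  have hsub : ∀ j, τ j ⊆ T.parts j := fun j => by
    rcases hτ j with h | h
    · simp [h]
    · exact h.2
  refine mem_partitionJoin S hne (Finset.biUnion_subset.2 fun j _ =>
    (hsub j).trans (T.parts_subset j)) fun i hi => ?_
  obtain ⟨v, hv⟩ := hi
  obtain ⟨hv1, hv2⟩ := Finset.mem_inter.1 hv
  obtain ⟨j, -, hvj⟩ := Finset.mem_biUnion.1 hv1
  have hvV := S.parts_subset i hv2
  -- A part of the finer partition `S` lies in a single part of `T`, so it meets only one of the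
  -- faces `τ j`.
  have hsubj : Finset.univ.biUnion τ ∩ S.parts i ⊆ τ j := by
    intro w hw
    obtain ⟨hw1, hw2⟩ := Finset.mem_inter.1 hw
    obtain ⟨l, -, hwl⟩ := Finset.mem_biUnion.1 hw1
    have hwV := S.parts_subset i hw2
    have h1 := (S.mem_parts_iff ⟨v, hvV⟩ i).1 hv2
    have h2 := (S.mem_parts_iff ⟨w, hwV⟩ i).1 hw2
    have h3 := (T.mem_parts_iff ⟨v, hvV⟩ j).1 (hsub j hvj)
    have h4 := (T.mem_parts_iff ⟨w, hwV⟩ l).1 (hsub l hwl)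
    have h5 := h _ _ (h1.trans h2.symm)
    rw [h3, h4] at h5
    exact h5 ▸ hwl
  have hj := (hτ j).resolve_left fun h0 => by simp [h0] at hvj
  exact (L.isRelLowerSet_faces hj.1).2 hsubj ⟨v, hv⟩

end Partitions

/-! ### The realization of the delta set as a space of height functions -/

section Heights

variable {ι : Type*} {V : Finset ι} [DecidableEq ι]

/-- The functions on `V` with minimum `0` and maximum `1`. -/
abbrev Heights (V : Finset ι) : Type _ :=
  {s : V → ℝ // (∀ v, 0 ≤ s v ∧ s v ≤ 1) ∧ (∃ v, s v = 0) ∧ ∃ v, s v = 1}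

/-- The height function given by a point of the simplex of an ordered partition `(I_1, …, I_m)`:
its increase from `I_i` to `I_{i+1}` is the `i`-th barycentric coordinate. -/
noncomputable def cellHeights {k : ℕ} (S : OrderedPartition V (k + 2))
    (a : stdSimplex ℝ (Fin (k + 1))) : Heights V :=
  ⟨fun v => cumSum a (S.index v), by
    have h0 : ∀ i, 0 ≤ a i := a.2.1
    have h1 : cumSum a (Fin.last _) = 1 := (cumSum_last _).trans (stdSimplex.sum_eq_one a)
    refine ⟨fun v => ⟨?_, ?_⟩, ?_, ?_⟩
    · rw [← cumSum_zero a]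
      exact cumSum_mono h0 (Fin.zero_le _)
    · rw [← h1]
      exact cumSum_mono h0 (Fin.le_last _)
    · obtain ⟨v, hv⟩ := S.index_surjective 0
      exact ⟨v, (congrArg (cumSum a) hv).trans (cumSum_zero _)⟩
    · obtain ⟨v, hv⟩ := S.index_surjective (Fin.last _)
      exact ⟨v, (congrArg (cumSum a) hv).trans h1⟩⟩

theorem coe_cellHeights {k : ℕ} (S : OrderedPartition V (k + 2))
    (a : stdSimplex ℝ (Fin (k + 1))) (v : V) :
    (cellHeights S a : V → ℝ) v = cumSum a (S.index v) := rfl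

/-- The comparison map from the realization of the delta set of ordered partitions to the space of
height functions. -/
noncomputable def PartitionSpace.heights : PartitionSpace V → Heights V :=
  Quot.lift (fun p => cellHeights p.1.2 p.2) (by
    rintro _ _ ⟨k, S, i, a⟩
    refine Subtype.ext (funext fun v => ?_)
    rw [coe_cellHeights, coe_cellHeights, cumSum_map_succAbove, OrderedPartition.index_face])

theorem PartitionSpace.continuous_heights :
    Continuous (PartitionSpace.heights : PartitionSpace V → Heights V) := by
  refine continuous_quot_lift _ (continuous_sigma fun S => ?_)
  refine Continuous.subtype_mk (continuous_pi fun v => ?_) _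
  change Continuous fun a : stdSimplex ℝ (Fin (S.1 + 1)) =>
    ∑ i : Fin (S.1 + 1), if i.castSucc < S.2.index v then (a : Fin (S.1 + 1) → ℝ) i else 0
  refine continuous_finsetSum _ fun i _ => ?_
  split_ifs
  · exact (continuous_apply i).comp continuous_subtype_val
  · exact continuous_const

instance : CompactSpace (PartitionSpace V) :=
  inferInstanceAs (CompactSpace (Quot (PartitionGlue V)))

/-- Every point of the realization is an interior point of a simplex. -/
theorem PartitionSpace.exists_cell_eq (γ : PartitionSpace V) :
    ∃ (k : ℕ) (S : OrderedPartition V (k + 2)) (a : stdSimplex ℝ (Fin (k + 1))),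
      (∀ i, 0 < a i) ∧ PartitionSpace.cell S a = γ := by
  have key : ∀ (k : ℕ) (S : OrderedPartition V (k + 2)) (a : stdSimplex ℝ (Fin (k + 1))),
      ∃ (l : ℕ) (T : OrderedPartition V (l + 2)) (b : stdSimplex ℝ (Fin (l + 1))),
        (∀ i, 0 < b i) ∧ PartitionSpace.cell T b = PartitionSpace.cell S a := by
    intro k
    induction k with
    | zero =>
      intro S a
      refine ⟨0, S, a, fun i => ?_, rfl⟩
      have h := stdSimplex.sum_eq_one a
      rw [Fin.sum_univ_one] at h
      rw [Fin.eq_zero i, h]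
      exact one_pos
    | succ k ih =>
      intro S a
      by_cases ha : ∀ i, 0 < a i
      · exact ⟨k + 1, S, a, ha, rfl⟩
      push Not at ha
      obtain ⟨i, hi⟩ := ha
      have hi0 : a i = 0 := le_antisymm hi (a.2.1 i)
      -- A vanishing coordinate `a i` puts the point on the `i`-th facet, which is glued to the
      -- simplex of `S.face i`, one dimension lower.
      let b : stdSimplex ℝ (Fin (k + 1)) := ⟨fun j => a (i.succAbove j), fun j => a.2.1 _, by
        have h := stdSimplex.sum_eq_one a
        rwa [Fin.sum_univ_succAbove _ i, hi0, zero_add] at h⟩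
      have hb : stdSimplex.map i.succAbove b = a := by
        refine DFunLike.ext _ _ fun j => ?_
        rw [stdSimplex.map_coe, FunOnFinite.linearMap_apply_apply, Finset.sum_filter]
        rcases Fin.eq_self_or_eq_succAbove i j with rfl | ⟨l, rfl⟩
        · rw [hi0]
          exact Finset.sum_eq_zero fun l _ => if_neg (Fin.succAbove_ne _ _)
        · rw [Finset.sum_eq_single l]
          · rw [if_pos rfl]; rfl
          · intro l' _ hl'
            exact if_neg fun h => hl' (Fin.succAbove_right_injective h)
          · simp
      obtain ⟨l, T, c, hc, h⟩ := ih (S.face i) b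
      refine ⟨l, T, c, hc, h.trans ?_⟩
      have := Quot.sound (PartitionGlue.glue k S i b)
      rwa [hb] at this
  induction γ using Quot.ind with
  | _ p => exact key p.1.1 p.1.2 p.2

/-- At interior points the cumulative sums are strictly increasing, so the set of values of the
height function determines them and the number of parts. The level sets then determine the
partition, and the gaps the barycentric coordinates. -/
theorem PartitionSpace.heights_injective :
    Function.Injective (PartitionSpace.heights : PartitionSpace V → Heights V) := by
  intro γ γ' h
  obtain ⟨k, S, a, ha, rfl⟩ := γ.exists_cell_eq
  obtain ⟨l, T, b, hb, rfl⟩ := γ'.exists_cell_eq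
  have hv : ∀ v, cumSum a (S.index v) = cumSum b (T.index v) := fun v =>
    congrFun (congrArg Subtype.val h) v
  have hr : Set.range (cumSum a) = Set.range (cumSum b) := by
    rw [← S.index_surjective.range_comp, ← T.index_surjective.range_comp]
    exact congrArg Set.range (funext hv)
  have hcard : k + 2 = l + 2 := by
    have h1 := Nat.card_range_of_injective (cumSum_strictMono ha).injective
    rw [hr, Nat.card_range_of_injective (cumSum_strictMono hb).injective] at h1
    simpa using h1.symm
  obtain rfl : k = l := by omega
  have hab : cumSum a = cumSum b :=
    ((cumSum_strictMono ha).range_inj (cumSum_strictMono hb)).1 hr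
  have hST : S = T := OrderedPartition.index_injective (funext fun v =>
    (cumSum_strictMono ha).injective ((hv v).trans (congrFun hab.symm _)))
  have hab' : a = b := DFunLike.ext _ _ fun i => by
    rw [← cumSum_succ_sub a, hab, cumSum_succ_sub]
  rw [hST, hab']

/-- The values `c` increase from `0` to `1`, so their successive differences are barycentric
coordinates. The length `m` is a variable so that `k + 2` can be substituted for it, unlike the
cardinality in `levelPartition`. -/
theorem exists_cellHeights_eq (s : Heights V) {m : ℕ} (S : OrderedPartition V m)
    (c : Fin m → ℝ) (hc : StrictMono c) (hs : ∀ v, (s : V → ℝ) v = c (S.index v)) :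
    ∃ (k : ℕ) (T : OrderedPartition V (k + 2)) (a : stdSimplex ℝ (Fin (k + 1))),
      cellHeights T a = s := by
  obtain ⟨h01, ⟨v₀, hv₀⟩, ⟨v₁, hv₁⟩⟩ := s.2
  have hm : 2 ≤ m := by
    by_contra hm
    have : (S.index v₀ : ℕ) = S.index v₁ := by omega
    have h := hs v₀
    rw [Fin.ext this, ← hs, hv₀, hv₁] at h
    exact zero_ne_one h
  obtain ⟨k, rfl⟩ : ∃ k, m = k + 2 := ⟨m - 2, by omega⟩
  have hc0 : c 0 = 0 := by
    obtain ⟨w, hw⟩ := S.index_surjective 0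
    refine le_antisymm ?_ ?_
    · rw [← hv₀, hs]
      exact hc.monotone (Fin.zero_le _)
    · rw [← hw, ← hs]
      exact (h01 w).1
  have hc1 : c (Fin.last _) = 1 := by
    obtain ⟨w, hw⟩ := S.index_surjective (Fin.last _)
    refine le_antisymm ?_ ?_
    · rw [← hw, ← hs]
      exact (h01 w).2
    · rw [← hv₁, hs]
      exact hc.monotone (Fin.le_last _)
  refine ⟨k, S, ⟨fun i => c i.succ - c i.castSucc,
    fun i => sub_nonneg.2 (hc.monotone (Fin.castSucc_lt_succ).le), ?_⟩, ?_⟩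
  · rw [← cumSum_last (fun i => c i.succ - c i.castSucc), cumSum_sub, hc0, hc1, sub_zero]
  · refine Subtype.ext (funext fun v => ?_)
    rw [hs]
    exact (cumSum_sub c _).trans (by rw [hc0, sub_zero])

theorem PartitionSpace.heights_surjective :
    Function.Surjective (PartitionSpace.heights : PartitionSpace V → Heights V) := by
  intro s
  obtain ⟨k, T, a, h⟩ := exists_cellHeights_eq s (levelPartition (s : V → ℝ)) _
    (OrderEmbedding.strictMono _) fun v => (index_levelPartition_eq_iff _ v _).1 rfl
  exact ⟨PartitionSpace.cell T a, h⟩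

/-- The realization of the delta set of ordered partitions is the space of height functions. -/
noncomputable def partitionHomeo (V : Finset ι) : PartitionSpace V ≃ₜ Heights V :=
  Continuous.homeoOfEquivCompactToT2
    (f := Equiv.ofBijective _
      ⟨PartitionSpace.heights_injective (V := V), PartitionSpace.heights_surjective⟩)
    PartitionSpace.continuous_heights

theorem partitionHomeo_cell {k : ℕ} (S : OrderedPartition V (k + 2))
    (a : stdSimplex ℝ (Fin (k + 1))) :
    partitionHomeo V (PartitionSpace.cell S a) = cellHeights S a := rfl

instance : CompactSpace (Heights V) := (partitionHomeo V).compactSpace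

/-- The simplex having the point in its interior has the level sets of `s` as its parts, so its join
is no larger than the second definition permits. -/
theorem exists_mem_range_cell (s : Heights V) :
    ∃ (k : ℕ) (S : OrderedPartition V (k + 2)),
      (partitionHomeo V).symm s ∈ Set.range (PartitionSpace.cell S) ∧
        ∀ v w, (s : V → ℝ) v = (s : V → ℝ) w → S.index v = S.index w := by
  obtain ⟨k, S, a, ha, h⟩ := ((partitionHomeo V).symm s).exists_cell_eq
  refine ⟨k, S, ⟨a, h⟩, fun v w hvw => ?_⟩
  have hs : cellHeights S a = s := by
    rw [← partitionHomeo_cell, h, Homeomorph.apply_symm_apply]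
  rw [← hs] at hvw
  exact (cumSum_strictMono ha).injective hvw

end Heights

/-! ### The cube as a cone on the space of height functions -/

section Rays

variable {ι : Type*} {V : Finset ι} (e : Fin V.card ≃ V)

theorem labels_eq_zero_or (y : Fin (V.card - 1) → D1) (v : V) :
    labels e y v = 0 ∨ ∃ i, labels e y v = y i := by
  unfold labels
  split_ifs with h
  · exact Or.inr ⟨_, rfl⟩
  · exact Or.inl rfl

/-- The vertex of index `i` among the vertices which are not last in the ordering. -/
def initVertex (i : Fin (V.card - 1)) : V := e ⟨i, by omega⟩

theorem labels_initVertex (y : Fin (V.card - 1) → D1) (i : Fin (V.card - 1)) :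
    labels e y (initVertex e i) = y i := by
  simp [labels, initVertex]

theorem nonempty_heights (hV : 2 ≤ V.card) : Nonempty (Heights V) := by
  classical
  obtain ⟨u, hu, w, hw, huw⟩ := Finset.one_lt_card.1 hV
  refine ⟨⟨fun v => if (v : ι) = u then 1 else 0, fun v => ?_, ⟨⟨w, hw⟩, ?_⟩, ⟨⟨u, hu⟩, ?_⟩⟩⟩
  · dsimp only
    split_ifs <;> norm_num
  · simp [huw.symm]
  · simp

variable (hV : 2 ≤ V.card)

/-- The last vertex of the ordering. -/
def lastVertex : V := e ⟨V.card - 1, by omega⟩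

theorem labels_lastVertex (y : Fin (V.card - 1) → D1) : labels e y (lastVertex e hV) = 0 := by
  simp [labels, lastVertex]

theorem eq_lastVertex_or (v : V) : v = lastVertex e hV ∨ ∃ i, v = initVertex e i := by
  by_cases h : (e.symm v : ℕ) < V.card - 1
  · exact Or.inr ⟨⟨e.symm v, h⟩, by simp [initVertex]⟩
  · refine Or.inl ?_
    rw [lastVertex, ← Equiv.symm_apply_eq]
    ext
    have := (e.symm v).2
    simp only
    omega

/-- The vector of height differences to the last vertex. -/
def relHeights (s : Heights V) : V → ℝ :=
  fun v => (s : V → ℝ) v - (s : V → ℝ) (lastVertex e hV)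

theorem continuous_relHeights : Continuous (relHeights e hV) :=
  continuous_pi fun v => ((continuous_apply v).comp continuous_subtype_val).sub
    ((continuous_apply _).comp continuous_subtype_val)

theorem norm_relHeights_pos (s : Heights V) : 0 < ‖relHeights e hV s‖ := by
  rw [norm_pos_iff]
  intro h
  obtain ⟨-, ⟨v, hv⟩, ⟨w, hw⟩⟩ := s.2
  have h1 := congrFun h v
  have h2 := congrFun h w
  simp only [relHeights, Pi.zero_apply, hv, hw] at h1 h2
  linarith

theorem abs_relHeights_div_le (s : Heights V) (v : V) :
    |relHeights e hV s v / ‖relHeights e hV s‖| ≤ 1 := by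
  rw [abs_div, abs_norm]
  exact (div_le_one (norm_relHeights_pos e hV s)).2 (norm_le_pi_norm (relHeights e hV s) v)

/-- The point at distance `r` from the center of the cube in the direction of the height
function `s`. -/
noncomputable def ray (r : unitInterval) (s : Heights V) : Fin (V.card - 1) → D1 := fun i =>
  ⟨r * (relHeights e hV s (initVertex e i) / ‖relHeights e hV s‖), by
    rw [Set.mem_Icc, ← abs_le, abs_mul, abs_of_nonneg r.2.1]
    exact mul_le_one₀ r.2.2 (abs_nonneg _) (abs_relHeights_div_le e hV s _)⟩

theorem continuous_ray : Continuous fun q : unitInterval × Heights V => ray e hV q.1 q.2 := by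
  refine continuous_pi fun i => Continuous.subtype_mk ?_ _
  have h := (continuous_relHeights e hV).comp (continuous_snd (X := unitInterval))
  refine (continuous_subtype_val.comp continuous_fst).mul (Continuous.div ?_ h.norm ?_)
  · exact (continuous_apply _).comp h
  · exact fun q => (norm_relHeights_pos e hV q.2).ne'

/-- Relative heights vanish at the last vertex, in agreement with the `0` appended by `labels`. -/
theorem labels_ray (r : unitInterval) (s : Heights V) :
    labels e (ray e hV r s) = ((r : ℝ) / ‖relHeights e hV s‖) • relHeights e hV s := by
  funext v
  rw [Pi.smul_apply, smul_eq_mul, div_mul_eq_mul_div, mul_div_assoc]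
  rcases eq_lastVertex_or e hV v with rfl | ⟨i, rfl⟩
  · rw [labels_lastVertex]
    simp [relHeights]
  · exact labels_initVertex e _ i

theorem norm_labels_ray (r : unitInterval) (s : Heights V) : ‖labels e (ray e hV r s)‖ = r := by
  have h := norm_relHeights_pos e hV s
  rw [labels_ray, norm_smul, Real.norm_eq_abs, abs_of_nonneg (div_nonneg r.2.1 h.le),
    div_mul_cancel₀ _ h.ne']

theorem ray_mem_boundary_iff (r : unitInterval) (s : Heights V) :
    (∃ i, (ray e hV r s i : ℝ) = -1 ∨ (ray e hV r s i : ℝ) = 1) ↔ r = 1 := by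
  have hn := norm_labels_ray e hV r s
  constructor
  · rintro ⟨i, hi⟩
    have h := norm_le_pi_norm (labels e (ray e hV r s)) (initVertex e i)
    rw [hn, labels_initVertex, Real.norm_eq_abs] at h
    have h1 : |(ray e hV r s i : ℝ)| = 1 := by rcases hi with hi | hi <;> rw [hi] <;> simp
    rw [h1] at h
    exact Subtype.ext (le_antisymm r.2.2 h)
  · rintro rfl
    have : Nonempty V := ⟨lastVertex e hV⟩
    obtain ⟨v, hv⟩ := exists_abs_eq_norm (labels e (ray e hV 1 s))
    rw [hn] at hv
    -- The norm `1` cannot be attained at the last vertex, whose label is `0`, so it is attained at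
    -- a coordinate of the cube.
    rcases labels_eq_zero_or e (ray e hV 1 s) v with h0 | ⟨i, hi⟩
    · rw [h0] at hv
      norm_num at hv
    · rw [hi] at hv
      exact ⟨i, ((abs_eq zero_le_one).1 hv).symm⟩

theorem labels_ray_eq_iff {r : unitInterval} (hr : r ≠ 0) (s : Heights V) (v w : V) :
    labels e (ray e hV r s) v = labels e (ray e hV r s) w ↔ (s : V → ℝ) v = (s : V → ℝ) w := by
  have h : (r : ℝ) / ‖relHeights e hV s‖ ≠ 0 :=
    div_ne_zero (fun h => hr (Subtype.ext h)) (norm_relHeights_pos e hV s).ne'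
  rw [labels_ray, Pi.smul_apply, Pi.smul_apply, smul_eq_mul, smul_eq_mul, mul_right_inj' h,
    relHeights, relHeights, sub_left_inj]

theorem labels_ray_eq_of_eq (r : unitInterval) (s : Heights V) {v w : V}
    (h : (s : V → ℝ) v = (s : V → ℝ) w) :
    labels e (ray e hV r s) v = labels e (ray e hV r s) w := by
  rw [labels_ray, Pi.smul_apply, Pi.smul_apply, relHeights, relHeights, h]

/-- The sup norm recovers `r`. For `r ≠ 0` the differences of `s` and `s'` are proportional with a
positive factor `c`; both functions have minimum `0` and maximum `1`, which forces `c = 1` and equal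
additive constants. -/
theorem ray_eq_ray {r r' : unitInterval} {s s' : Heights V}
    (h : ray e hV r s = ray e hV r' s') : r = r' ∧ (r ≠ 0 → s = s') := by
  have hr : r = r' := Subtype.ext (by rw [← norm_labels_ray e hV r s, h, norm_labels_ray])
  refine ⟨hr, fun hr0 => ?_⟩
  subst hr
  have hl : ((r : ℝ) / ‖relHeights e hV s‖) • relHeights e hV s =
      ((r : ℝ) / ‖relHeights e hV s'‖) • relHeights e hV s' := by
    rw [← labels_ray, h, labels_ray]
  have hpos : 0 < (r : ℝ) := lt_of_le_of_ne r.2.1 fun h => hr0 (Subtype.ext h.symm)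
  obtain ⟨c, hc, hcs⟩ : ∃ c : ℝ, 0 < c ∧
      ∀ v w, (s' : V → ℝ) v - (s' : V → ℝ) w = c * ((s : V → ℝ) v - (s : V → ℝ) w) := by
    have h1 := norm_relHeights_pos e hV s
    have h2 := norm_relHeights_pos e hV s'
    refine ⟨‖relHeights e hV s'‖ / ‖relHeights e hV s‖, div_pos h2 h1, fun v w => ?_⟩
    have key : ∀ u, relHeights e hV s' u =
        ‖relHeights e hV s'‖ / ‖relHeights e hV s‖ * relHeights e hV s u := fun u => by
      have := congrFun hl u
      simp only [Pi.smul_apply, smul_eq_mul] at this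
      field_simp at this ⊢
      linarith
    have hv := key v
    have hw := key w
    simp only [relHeights] at hv hw ⊢
    linear_combination hv - hw
  obtain ⟨h01, ⟨v₀, hv₀⟩, ⟨v₁, hv₁⟩⟩ := s.2
  obtain ⟨h01', ⟨w₀, hw₀⟩, ⟨w₁, hw₁⟩⟩ := s'.2
  have hc1 : c ≤ 1 := by
    have := hcs v₁ v₀
    rw [hv₀, hv₁] at this
    linarith [(h01' v₁).2, (h01' v₀).1]
  have hc2 : 1 ≤ c := by
    have := hcs w₁ w₀
    rw [hw₀, hw₁] at this
    nlinarith [(h01 w₁).2, (h01 w₀).1]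
  obtain rfl : c = 1 := le_antisymm hc1 hc2
  refine Subtype.ext (funext fun v => ?_)
  -- With `w₀` and `v₀` the minimum points of `s'` and `s`, this reads `-s' v₀ = s w₀`; both values
  -- are nonnegative, so `s' v₀ = 0`.
  have h1 := hcs w₀ v₀
  have h2 := hcs v v₀
  linarith [(h01 w₀).1, (h01' v₀).1]

theorem ray_zero_eq_zero (s : Heights V) (i : Fin (V.card - 1)) :
    (ray e hV 0 s i : ℝ) = 0 := by
  simp [ray]

theorem ray_surjective :
    Function.Surjective fun q : unitInterval × Heights V => ray e hV q.1 q.2 := by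
  intro y
  have hlast := labels_lastVertex e hV y
  have hinit := labels_initVertex e y
  have hle : ∀ v, |labels e y v| ≤ 1 := fun v => by
    rcases labels_eq_zero_or e y v with h | ⟨i, h⟩
    · simp [h]
    · rw [h]
      exact abs_le.2 (y i).2
  generalize labels e y = l at hlast hinit hle
  have : Nonempty V := ⟨lastVertex e hV⟩
  obtain ⟨v₀, hv₀⟩ := Finite.exists_min l
  obtain ⟨v₁, hv₁⟩ := Finite.exists_max l
  -- Constant labels equal the label `0` of the last vertex: this is the center, reached with radius
  -- `0` from any `s`. Otherwise the labels are rescaled affinely onto `[0,1]` and the radius is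
  -- their norm.
  rcases (hv₀ v₁).eq_or_lt with h | h
  · obtain ⟨s⟩ := nonempty_heights hV
    refine ⟨(0, s), funext fun i => Subtype.ext ?_⟩
    change (ray e hV 0 s i : ℝ) = _
    rw [ray_zero_eq_zero, ← hinit, ← hlast]
    exact le_antisymm (((hv₁ _).trans h.ge).trans (hv₀ _)) (((hv₁ _).trans h.ge).trans (hv₀ _))
  · have hpos : 0 < l v₁ - l v₀ := sub_pos.2 h
    let s : Heights V := ⟨fun v => (l v - l v₀) / (l v₁ - l v₀), fun v =>
      ⟨div_nonneg (sub_nonneg.2 (hv₀ v)) hpos.le, (div_le_one hpos).2 (by linarith [hv₁ v])⟩,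
      ⟨v₀, by simp⟩, ⟨v₁, div_self hpos.ne'⟩⟩
    have hs : relHeights e hV s = (l v₁ - l v₀)⁻¹ • l := by
      funext v
      change (l v - l v₀) / (l v₁ - l v₀) - (l (lastVertex e hV) - l v₀) / (l v₁ - l v₀) =
        (l v₁ - l v₀)⁻¹ * l v
      rw [hlast]
      ring
    have hn : ‖relHeights e hV s‖ = (l v₁ - l v₀)⁻¹ * ‖l‖ := by
      rw [hs, norm_smul, Real.norm_eq_abs, abs_of_pos (inv_pos.2 hpos)]
    have hl : 0 < ‖l‖ := norm_pos_iff.2 fun h0 => by simp [h0] at hpos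
    refine ⟨(⟨‖l‖, norm_nonneg _, (pi_norm_le_iff_of_nonneg zero_le_one).2 hle⟩, s),
      funext fun i => Subtype.ext ?_⟩
    change ‖l‖ * (relHeights e hV s (initVertex e i) / ‖relHeights e hV s‖) = _
    rw [hn, hs, ← hinit, Pi.smul_apply, smul_eq_mul]
    field_simp

end Rays

/-! ### The first and second definitions -/

section FirstAndSecond

variable {ι : Type*} {V : Finset ι} [DecidableEq ι]

theorem base_mem_suspJoin (L : PreAbstractSimplicialComplex ι) {m : ℕ}
    (S : OrderedPartition V m) : Susp.base _ ∈ suspJoin L S :=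
  ⟨Susp.base _, rfl⟩

/-- The map of the first definition descends along the ray map, because at radius `0`, the only
place where rays meet, its value does not depend on the point of `|𝒦_n|`. -/
theorem HasMap1.hasMap2 {L K : PreAbstractSimplicialComplex ι} (hLK : IsPairOn V L K)
    (hV : 2 ≤ V.card) (e : Fin V.card ≃ V) (h : HasMap1 V L K) : HasMap2 V e L K := by
  obtain ⟨Ψ, hbase, hzero, hcell⟩ := h
  let f : (unitInterval × Heights V) × Susp (realization V K) →
      (Fin (V.card - 1) → D1) × Susp (realization V K) :=
    Prod.map (fun q => ray e hV q.1 q.2) id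
  -- A product of a quotient map with an identity need not be a quotient map. Here the ray map is
  -- proper, which survives the product and makes `f` a closed surjection.
  have hf : IsQuotientMap f :=
    (((continuous_ray e hV).isProperMap).prodMap isProperMap_id).isClosedMap.isQuotientMap
      ((continuous_ray e hV).prodMap continuous_id)
      ((ray_surjective e hV).prodMap Function.surjective_id)
  let F : C((unitInterval × Heights V) × Susp (realization V K), Susp (stdSimplex ℝ V)) :=
    ⟨fun p => Ψ ((partitionHomeo V).symm p.1.2, Collapse.mk _ (p.1.1, p.2)),
      Ψ.continuous.comp (((partitionHomeo V).symm.continuous.comp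
        (continuous_snd.comp continuous_fst)).prodMk ((Collapse.continuous_mk _).comp
          ((continuous_fst.comp continuous_fst).prodMk continuous_snd)))⟩
  have hF : ∀ r s x,
      F ((r, s), x) = Ψ ((partitionHomeo V).symm s, Collapse.mk _ (r, x)) := fun _ _ _ => rfl
  have hfac : Function.FactorsThrough F f := by
    rintro ⟨⟨r, s⟩, x⟩ ⟨⟨r', s'⟩, x'⟩ h
    obtain rfl : x = x' := congrArg Prod.snd h
    obtain ⟨rfl, hs⟩ := ray_eq_ray e hV (congrArg Prod.fst h)
    rcases eq_or_ne r 0 with rfl | hr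
    · rw [hF, hF, hzero, hzero]
    · obtain rfl : s = s' := hs hr
      rfl
  let G := IsQuotientMap.lift (f := ⟨f, hf.continuous⟩) hf F hfac
  have hG : ∀ r s x, G (ray e hV r s, x) = F ((r, s), x) := fun r s x =>
    DFunLike.congr_fun (IsQuotientMap.lift_comp (f := ⟨f, hf.continuous⟩) hf F hfac) ((r, s), x)
  have hG0 : ∀ p ∈ redSuspSet (V.card - 1) (Susp.base (realization V K)), G p = Susp.base _ := by
    rintro ⟨y, x⟩ hp
    obtain ⟨⟨r, s⟩, rfl⟩ := ray_surjective e hV y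
    have hm : (r, x) ∈ coneSet (Susp.base (realization V K)) := by
      rcases hp with hp | hp
      · exact Or.inl ((ray_mem_boundary_iff e hV r s).1 hp)
      · exact Or.inr hp
    rw [hG, hF, Collapse.mk_eq_base hm, hbase]
  refine ⟨⟨Collapse.lift G (Susp.base _) hG0, Collapse.continuous_lift _ G.continuous⟩, rfl,
    fun y _ => ?_⟩
  obtain ⟨⟨r, s⟩, rfl⟩ := ray_surjective e hV y
  have hr0 : r = 0 → ∀ x, G (ray e hV r s, x) = suspIncl V K x := by
    rintro rfl x
    rw [hG, hF, hzero]
  refine ⟨fun hy x => hr0 ?_ x, fun x => ?_⟩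
  · have h0 : labels e (ray e hV r s) = 0 := funext fun v => by
      rcases labels_eq_zero_or e (ray e hV r s) v with h | ⟨i, h⟩
      · exact h
      · exact h.trans (hy i)
    exact Subtype.ext (by rw [← norm_labels_ray e hV r s, h0, norm_zero]; rfl)
  · change G (ray e hV r s, x) ∈ _
    -- At the center the level partition has a single part and is no simplex of `𝒦_n`, so `hcell`
    -- says nothing and `K ⊆ L` is used.
    rcases eq_or_ne r 0 with hr | hr
    · rw [hr0 hr]
      exact range_suspIncl_subset_suspJoin hLK _ ⟨x, rfl⟩
    · obtain ⟨k, S, hS, hSs⟩ := exists_mem_range_cell s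
      rw [hG, hF]
      refine suspJoin_mono L _ S (fun v w hvw => hSs v w ?_) (hcell k S _ hS _)
      exact (labels_ray_eq_iff e hV hr s v w).1 ((index_levelPartition_eq_index_iff _ v w).1 hvw)

/-- Composition with the ray map; the boundary of the cube, at radius `1`, supplies the base of the
cone. -/
theorem HasMap2.hasMap1 {L K : PreAbstractSimplicialComplex ι} (hV : 2 ≤ V.card)
    {e : Fin V.card ≃ V} (h : HasMap2 V e L K) : HasMap1 V L K := by
  obtain ⟨Ψ, hbase, h⟩ := h
  let F : C((unitInterval × Susp (realization V K)) × Heights V, Susp (stdSimplex ℝ V)) :=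
    ⟨fun p => Ψ (Collapse.mk _ (ray e hV p.1.1 p.2, p.1.2)),
      Ψ.continuous.comp ((Collapse.continuous_mk _).comp
        (((continuous_ray e hV).comp ((continuous_fst.comp continuous_fst).prodMk
          continuous_snd)).prodMk (continuous_snd.comp continuous_fst)))⟩
  have hF : ∀ p ∈ coneSet (Susp.base (realization V K)),
      F.curry p = ContinuousMap.const _ (Susp.base _) := by
    rintro ⟨r, x⟩ hp
    ext s
    change Ψ (Collapse.mk _ (ray e hV r s, x)) = _
    have hm : (ray e hV r s, x) ∈ redSuspSet (V.card - 1) (Susp.base (realization V K)) := by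
      rcases hp with hp | hp
      · exact Or.inl ((ray_mem_boundary_iff e hV r s).2 hp)
      · exact Or.inr hp
    rw [Collapse.mk_eq_base hm, hbase]
    rfl
  -- The cone is a quotient, and continuity must hold on its product with `|𝒦_n|`. Currying lets the
  -- map descend to the cone first; uncurrying is allowed because the space of heights is compact
  -- Hausdorff.
  let G : C(Cone (Susp.base (realization V K)), C(Heights V, Susp (stdSimplex ℝ V))) :=
    ⟨Collapse.lift F.curry _ hF, Collapse.continuous_lift _ F.curry.continuous⟩
  have hGb : ∀ s, G (Collapse.base _) s = Susp.base _ := fun _ => rfl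
  have hG : ∀ r x s, G (Collapse.mk _ (r, x)) s = Ψ (Collapse.mk _ (ray e hV r s, x)) :=
    fun _ _ _ => rfl
  refine ⟨⟨fun p => G p.2 (partitionHomeo V p.1),
    (ContinuousMap.continuous_uncurry_of_continuous G).comp
      (continuous_snd.prodMk ((partitionHomeo V).continuous.comp continuous_fst))⟩,
    fun γ => hGb (partitionHomeo V γ), fun γ x => ?_, ?_⟩
  · change G (Collapse.mk _ (0, x)) (partitionHomeo V γ) = _
    rw [hG]
    have h0 := ray_zero_eq_zero e hV (partitionHomeo V γ)
    exact (h _ fun i => by rw [h0]; norm_num).1 h0 x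
  · rintro k S _ ⟨a, rfl⟩ c
    change G c (partitionHomeo V (PartitionSpace.cell S a)) ∈ _
    rw [partitionHomeo_cell]
    induction c using Collapse.ind with
    | base => exact base_mem_suspJoin L S
    | mk p =>
      obtain ⟨r, x⟩ := p
      rw [hG]
      -- On the boundary of the cube condition (2) is not imposed, but there the map takes the value
      -- `*₋₁`.
      by_cases hr : r = 1
      · have hm : (ray e hV r (cellHeights S a), x) ∈
            redSuspSet (V.card - 1) (Susp.base (realization V K)) :=
          Or.inl ((ray_mem_boundary_iff e hV r _).2 hr)
        rw [Collapse.mk_eq_base hm, hbase]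
        exact base_mem_suspJoin L S
      · have hy : ∀ i, (ray e hV r (cellHeights S a) i : ℝ) ≠ -1 ∧
            (ray e hV r (cellHeights S a) i : ℝ) ≠ 1 := fun i =>
          ⟨fun h => hr ((ray_mem_boundary_iff e hV r _).1 ⟨i, Or.inl h⟩),
            fun h => hr ((ray_mem_boundary_iff e hV r _).1 ⟨i, Or.inr h⟩)⟩
        -- Labels are constant on the parts of `S` throughout its closed simplex, so `S` refines the
        -- level partition, possibly strictly.
        refine suspJoin_mono L S _ (fun v w hvw => ?_) ((h _ hy).2 x)
        rw [index_levelPartition_eq_index_iff]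
        refine labels_ray_eq_of_eq e hV r _ ?_
        rw [coe_cellHeights, coe_cellHeights, hvw]

theorem hasMap1_iff_hasMap2 {L K : PreAbstractSimplicialComplex ι} (hLK : IsPairOn V L K)
    (hV : 2 ≤ V.card) (e : Fin V.card ≃ V) : HasMap1 V L K ↔ HasMap2 V e L K :=
  ⟨HasMap1.hasMap2 hLK hV e, HasMap2.hasMap1 hV⟩

end FirstAndSecond

/-! ### The recursion and independence of the vertex orderings -/

section Recursion

variable {ι : Type*}

/-- With fewer than two vertices `|𝒦_n|` is empty and carries no information; such pairs satisfy a
base clause of every definition. -/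
theorem IsPairOn.eq_bot_or_single {V : Finset ι} {L K : PreAbstractSimplicialComplex ι}
    (h : IsPairOn V L K) (hV : V.card < 2) : K = ⊥ ∨ ∃ v, L.faces = {{v}} := by
  have hcard : V.card = 0 ∨ V.card = 1 := by omega
  rcases hcard with h0 | h1
  · left
    rw [Finset.card_eq_zero] at h0
    subst h0
    refine le_bot_iff.1 fun σ hσ => ?_
    have hL : σ ∈ L.faces := h.le hσ
    have hne := (L.isRelLowerSet_faces hL).1
    exact absurd (Finset.subset_empty.1 (h.faces_subset σ hL)) hne.ne_empty
  · right
    obtain ⟨v, rfl⟩ := Finset.card_eq_one.1 h1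
    refine ⟨v, Set.Subset.antisymm (fun σ hσ => ?_) ?_⟩
    · have hne : σ.Nonempty := (L.isRelLowerSet_faces hσ).1
      exact hne.subset_singleton_iff.1 (h.faces_subset σ hσ)
    · rintro _ rfl
      exact h.vertex_mem v (Finset.mem_singleton_self v)

variable [DecidableEq ι]

theorem IsPairOn.erase {V : Finset ι} {L K : PreAbstractSimplicialComplex ι}
    (h : IsPairOn V L K) (i : ι) :
    IsPairOn (V.erase i) (restrict L (V.erase i)) (restrict K (V.erase i)) where
  le := fun _ hσ => ⟨h.le hσ.1, hσ.2⟩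
  faces_subset := fun _ hσ => hσ.2
  vertex_mem := fun v hv =>
    ⟨h.vertex_mem v (Finset.mem_of_mem_erase hv), Finset.singleton_subset_iff.2 hv⟩

/-- The recursive definition only depends on the condition for pairs with at least two vertices. -/
theorem GolodScheme.mono
    {P Q : Finset ι → PreAbstractSimplicialComplex ι → PreAbstractSimplicialComplex ι → Prop}
    (hPQ : ∀ V L K, IsPairOn V L K → 2 ≤ V.card → P V L K → Q V L K)
    {V : Finset ι} {L K : PreAbstractSimplicialComplex ι} (hLK : IsPairOn V L K)
    (h : GolodScheme P V L K) : GolodScheme Q V L K := by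
  induction h with
  | single V L K v hL => exact GolodScheme.single V L K v hL
  | empty V L K hK => exact GolodScheme.empty V L K hK
  | step V L K _ hmap ih =>
    rcases lt_or_ge V.card 2 with hV | hV
    · rcases hLK.eq_bot_or_single hV with hK | ⟨v, hL⟩
      · exact GolodScheme.empty V L K hK
      · exact GolodScheme.single V L K v hL
    · exact GolodScheme.step V L K (fun i hi => ih i hi (hLK.erase i)) (hPQ V L K hLK hV hmap)

theorem GolodScheme.congr
    {P Q : Finset ι → PreAbstractSimplicialComplex ι → PreAbstractSimplicialComplex ι → Prop}
    (hPQ : ∀ V L K, IsPairOn V L K → 2 ≤ V.card → (P V L K ↔ Q V L K))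
    {V : Finset ι} {L K : PreAbstractSimplicialComplex ι} (hLK : IsPairOn V L K) :
    GolodScheme P V L K ↔ GolodScheme Q V L K :=
  ⟨GolodScheme.mono (fun V L K h hV => (hPQ V L K h hV).1) hLK,
    GolodScheme.mono (fun V L K h hV => (hPQ V L K h hV).2) hLK⟩

/-- The left side involves no ordering, so it links any two choices of `o`. -/
theorem coherentlyGolod1_iff_coherentlyGolod2With (o : VertexOrdering ι) {V : Finset ι}
    {L K : PreAbstractSimplicialComplex ι} (hLK : IsPairOn V L K) :
    CoherentlyGolod1 V L K ↔ CoherentlyGolod2With o V L K :=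
  GolodScheme.congr (fun V _ _ h hV => hasMap1_iff_hasMap2 h hV (o V)) hLK

theorem coherentlyGolod1_iff_coherentlyGolod2 {V : Finset ι}
    {L K : PreAbstractSimplicialComplex ι} (hLK : IsPairOn V L K) :
    CoherentlyGolod1 V L K ↔ CoherentlyGolod2 V L K :=
  GolodScheme.congr (fun V _ _ h hV =>
    ⟨fun h1 => ⟨V.equivFin.symm, h1.hasMap2 h hV _⟩, fun ⟨_, h2⟩ => h2.hasMap1 hV⟩) hLK

theorem coherentlyGolod2_iff_coherentlyGolod3 {V : Finset ι}
    {L K : PreAbstractSimplicialComplex ι} (hLK : IsPairOn V L K) :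
    CoherentlyGolod2 V L K ↔ CoherentlyGolod3 V L K :=
  GolodScheme.congr (fun _ L K _ _ => exists_congr fun e => hasMap2_iff_hasMap3 e L K) hLK

theorem coherentlyGolod2With_iff_coherentlyGolod3With (o : VertexOrdering ι) {V : Finset ι}
    {L K : PreAbstractSimplicialComplex ι} (hLK : IsPairOn V L K) :
    CoherentlyGolod2With o V L K ↔ CoherentlyGolod3With o V L K :=
  GolodScheme.congr (fun V L K _ _ => hasMap2_iff_hasMap3 (o V) L K) hLK

end Recursion

end CoherentGolod

theorem mainTheorem11 {ι : Type*} [DecidableEq ι] (V : Finset ι)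
    (L K : PreAbstractSimplicialComplex ι) (hLK : CoherentGolod.IsPairOn V L K) :
    ((CoherentGolod.CoherentlyGolod1 V L K ↔ CoherentGolod.CoherentlyGolod2 V L K) ∧
      (CoherentGolod.CoherentlyGolod2 V L K ↔ CoherentGolod.CoherentlyGolod3 V L K)) ∧
    (∀ o : CoherentGolod.VertexOrdering ι,
      (CoherentGolod.CoherentlyGolod2With o V L K ↔ CoherentGolod.CoherentlyGolod2 V L K) ∧
      (CoherentGolod.CoherentlyGolod3With o V L K ↔ CoherentGolod.CoherentlyGolod3 V L K)) ∧
    (∀ o o' : CoherentGolod.VertexOrdering ι,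
      (CoherentGolod.CoherentlyGolod2With o V L K →
        CoherentGolod.CoherentlyGolod2With o' V L K) ∧
      (CoherentGolod.CoherentlyGolod3With o V L K →
        CoherentGolod.CoherentlyGolod3With o' V L K)) := by
  have h12 := CoherentGolod.coherentlyGolod1_iff_coherentlyGolod2 hLK
  have h23 := CoherentGolod.coherentlyGolod2_iff_coherentlyGolod3 hLK
  have h12o := fun o => CoherentGolod.coherentlyGolod1_iff_coherentlyGolod2With o hLK
  have h23o := fun o => CoherentGolod.coherentlyGolod2With_iff_coherentlyGolod3With o hLK
  have h2 := fun o => (h12o o).symm.trans h12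
  have h3 := fun o => ((h23o o).symm.trans (h2 o)).trans h23
  exact ⟨⟨h12, h23⟩, fun o => ⟨h2 o, h3 o⟩,
    fun o o' => ⟨fun h => (h2 o').2 ((h2 o).1 h), fun h => (h3 o').2 ((h3 o).1 h)⟩⟩
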